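/- Let $d\ge 1$ and $n\ge 1$ be integers and let $p>n$ be real. Let $G:\mathbb{R}_{\ge 0}\to\mathbb{R}_{\ge 0}$ vanish at the origin and be real-analytic near it: for some $R>0$ and real $c_k$, $G(x)=\sum_{k\ge 1}\frac{c_k}{k!}x^k$ for $0\le x<R$. Let $a_0\in\mathcal{S}(\mathbb{R}^d;\mathbb{C})$, let $\beta\in\mathcal{S}(\mathbb{R}^d;\mathbb{R})$ have compact support, let $T>0$ be such that $\operatorname{supp}\beta\subset\{|x|<T\}$, and let $\xi\in\mathbb{R}^d$ with $|\xi|=1$. For $\varepsilon>0$ put $$a(t,x)=a_0(x+\varepsilon^{1-2n}t\xi)\exp\Big(-i\varepsilon^{-2n}G\big(\varepsilon^{2p}|a_0(x+\varepsilon^{1-2n}t\xi)|^2\big)\int_0^t\beta\big(\varepsilon^{-1}x+\varepsilon^{-2n}(t-s)\xi-T\xi\big)\,ds\Big),$$ $$v(t,x)=\varepsilon^p\,a\big(\varepsilon^{2n}(t+T),\varepsilon(x+T\xi)\big)\,e^{i(x\cdot\xi+\frac{t}{2n})}.$$ Let $\mathcal{F}L^1$ be the space of (continuous) functions $w=\mathcal{F}^{-1}\widehat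 w$ with $\widehat w\in L^1(\mathbb{R}^d)$, where $\mathcal{F}^{-1}f(x)=(2\pi)^{-d/2}\int e^{ix\cdot y}f(y)\,dy$, normed by $\|w\|_{\mathcal{F}L^1}=\|\widehat w\|_{L^1}$. A solution on $[-T,T]$ of $$\big(i\partial_t+\tfrac{1}{2n}(-\Delta)^n\big)u=\beta\,G(|u|^2)\,u,\qquad u(-T)=v(-T),\qquad(\ast)$$ is a function $u\in C([-T,T];\mathcal{F}L^1)$ with $\beta G(|u|^2)u\in L^1([-T,T];\mathcal{F}L^1)$, $\beta G(|u(t)|^2)u(t)\in\mathcal{F}L^1$ for every $t\in[-T,T]$, $u(-T)=v(-T)$ and, for all $t\in[-T,T]$, $$u(t)=e^{i(t+T)(-\Delta)^n/2n}v(-T)-i\int_{-T}^t e^{i(t-s)(-\Delta)^n/2n}\big[\beta G(|u|^2)u\big](s)\,ds .$$ Then there is $\varepsilon_0>0$ such that for every $0<\varepsilon<\varepsilon_0$ equation $(\ast)$ has a unique solution $u=u_\varepsilon$ on $[-T,T]$, and for every $\sigma>0$ there is a constant $C>0$, independent of $\varepsilon$, such that for all $0<\varepsilon<\varepsilon_0$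 $$\sup_{t\in[-T,T]}\|u_\varepsilon(t)-v(t)\|_{\mathcal{F}L^1}\le C\max\{\varepsilon^{p+2},\varepsilon^{3p-2n-\sigma}\}.$$ Moreover, the phase of $v$ at the final time carries the X-ray transform $X(y,\xi)=\int_{\mathbb{R}}\beta(y+\tau\xi)\,d\tau$: for every $\varepsilon>0$ and every $y\in\mathbb{R}^d$ with $y\cdot\xi=0$, $$v(T,y-T\xi)=\varepsilon^p A\,\exp\big(-i\,G(\varepsilon^{2p}|A|^2)\,X(y,\xi)\big)\,e^{i(-T+\frac{T}{2n})},\qquad A=a_0(\varepsilon(y+2T\xi)).$$ -/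

import Mathlib

open MeasureTheory Set
open scoped NNReal ENNReal

noncomputable section

namespace HigherNLS

/-- Euclidean space `ℝ^d`. -/
abbrev E (d : ℕ) : Type := EuclideanSpace ℝ (Fin d)

/-- The Banach space `L¹(ℝ^d; ℂ)`. -/
abbrev L1 (d : ℕ) : Type := Lp ℂ 1 (volume : Measure (E d))

/-- Inverse Fourier transform, unitary convention:
`(F⁻¹ f)(x) = (2π)^(-d/2) ∫ e^{i x·y} f(y) dy`. -/
def invFourier {d : ℕ} (f : E d → ℂ) (x : E d) : ℂ :=
  (((2 * Real.pi) ^ (-(d : ℝ) / 2) : ℝ) : ℂ) *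
    ∫ y : E d, Complex.exp (Complex.I * ((inner ℝ x y : ℝ) : ℂ)) * f y

/-- `w` belongs to the Fourier-Lebesgue space `FL¹(ℝ^d)`: it is the inverse Fourier transform of an
`L¹` function. (Elements of `FL¹` are continuous; we use the continuous representative.) -/
def MemFL1 {d : ℕ} (w : E d → ℂ) : Prop :=
  ∃ f : L1 d, ∀ x, w x = invFourier (fun y => f y) x

open Classical in
/-- The Fourier transform of `w ∈ FL¹`, that is, the (unique) `f ∈ L¹` with `w = F⁻¹ f`;
by convention `0` if `w ∉ FL¹`. -/
def fourierFL1 {d : ℕ} (w : E d → ℂ) : L1 d :=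
  if h : MemFL1 w then h.choose else 0

open Classical in
/-- The norm `‖w‖_{FL¹} = ‖ŵ‖_{L¹}`, equal to `∞` if `w ∉ FL¹`. -/
def normFL1 {d : ℕ} (w : E d → ℂ) : ℝ≥0∞ :=
  if MemFL1 w then ‖fourierFL1 w‖ₑ else ⊤

/-- The norm of `L^∞_t FL¹([-T,T] × ℝ^d)`, with the supremum over all times. -/
def normLinftyFL1 {d : ℕ} (T : ℝ) (w : ℝ → E d → ℂ) : ℝ≥0∞ :=
  ⨆ t ∈ Icc (-T) T, normFL1 (w t)

/-- Fourier symbol `exp(i t |y|^{2n} / (2n))` of `e^{it(-Δ)^n/2n}`. -/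
def symbol {d : ℕ} (n : ℕ) (t : ℝ) (y : E d) : ℂ :=
  Complex.exp (Complex.I * ((t * ‖y‖ ^ (2 * n) / (2 * n) : ℝ) : ℂ))

theorem integrable_symbol_mul {d : ℕ} (n : ℕ) (t : ℝ) (f : L1 d) :
    Integrable (fun y : E d => symbol n t y * f y) := by
  refine (L1.integrable_coeFn f).bdd_mul (c := 1) ?_ ?_
  · have : Continuous (fun y : E d => symbol n t y) := by unfold symbol; fun_prop
    exact this.aestronglyMeasurable
  · refine Filter.Eventually.of_forall fun y => ?_
    rw [symbol, mul_comm, Complex.norm_exp_ofReal_mul_I]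

/-- The group `e^{it(-Δ)^n/2n}` on the Fourier side: multiplication by its symbol on `L¹`. -/
def propagator {d : ℕ} (n : ℕ) (t : ℝ) (f : L1 d) : L1 d :=
  (integrable_symbol_mul n t f).toL1 _

/-- The nonlinearity `β G(|w|²) w`. -/
def nonlinearity {d : ℕ} (G : ℝ≥0 → ℝ≥0) (β : E d → ℝ) (w : E d → ℂ) (x : E d) : ℂ :=
  ((β x * (G (‖w x‖₊ ^ 2) : ℝ) : ℝ) : ℂ) * w x

/-- `u` is a solution on `[-T,T]`, in `C([-T,T]; FL¹)`, of
`(i∂_t + (-Δ)^n/(2n)) u = β G(|u|²) u`, `u(-T) = u₀`, in the sense of the Duhamel formula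
`u(t) = e^{i(t+T)(-Δ)^n/2n} u₀ - i ∫_{-T}^t e^{i(t-s)(-Δ)^n/2n} [β G(|u|²) u](s) ds`,
an identity in `FL¹` that is written here for the Fourier transforms, with a Bochner integral
in `L¹`. -/
structure IsSolution {d : ℕ} (n : ℕ) (G : ℝ≥0 → ℝ≥0) (β : E d → ℝ) (T : ℝ)
    (u₀ : E d → ℂ) (u : ℝ → E d → ℂ) : Prop where
  mem : ∀ t ∈ Icc (-T) T, MemFL1 (u t)
  continuousOn : ContinuousOn (fun t => fourierFL1 (u t)) (Icc (-T) T)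
  mem_nonlinearity : ∀ t ∈ Icc (-T) T, MemFL1 (nonlinearity G β (u t))
  integrable_nonlinearity :
    IntervalIntegrable (fun t => fourierFL1 (nonlinearity G β (u t))) volume (-T) T
  initial : u (-T) = u₀
  duhamel : ∀ t ∈ Icc (-T) T,
    fourierFL1 (u t) = propagator n (t + T) (fourierFL1 u₀)
      - Complex.I • ∫ s in (-T)..t, propagator n (t - s) (fourierFL1 (nonlinearity G β (u s)))

/-- The amplitude
`a(t,x) = a₀(x + ε^{1-2n} t ξ) exp(-i ε^{-2n} G(ε^{2p} |a₀(x + ε^{1-2n} t ξ)|²)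
  ∫_0^t β(ε^{-1} x + ε^{-2n} (t-s) ξ - T ξ) ds)`. -/
def amplitude {d : ℕ} (n : ℕ) (p : ℝ) (G : ℝ≥0 → ℝ≥0) (a₀ : E d → ℂ) (β : E d → ℝ)
    (T : ℝ) (ξ : E d) (ε : ℝ) (t : ℝ) (x : E d) : ℂ :=
  let A : ℂ := a₀ (x + (ε ^ (1 - 2 * (n : ℤ)) * t) • ξ)
  A * Complex.exp (-Complex.I *
    ((ε ^ (-(2 * (n : ℤ))) * (G (Real.toNNReal (ε ^ (2 * p) * ‖A‖ ^ 2)) : ℝ) *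
      ∫ s in (0 : ℝ)..t, β (ε⁻¹ • x + (ε ^ (-(2 * (n : ℤ))) * (t - s)) • ξ - T • ξ) : ℝ) : ℂ))

/-- The wave packet
`v(t,x) = ε^p a(ε^{2n} (t+T), ε (x + T ξ)) e^{i (x·ξ + t/(2n))}`. -/
def wavePacket {d : ℕ} (n : ℕ) (p : ℝ) (G : ℝ≥0 → ℝ≥0) (a₀ : E d → ℂ) (β : E d → ℝ)
    (T : ℝ) (ξ : E d) (ε : ℝ) (t : ℝ) (x : E d) : ℂ :=
  ((ε ^ p : ℝ) : ℂ) * amplitude n p G a₀ β T ξ ε (ε ^ (2 * n) * (t + T)) (ε • (x + T • ξ)) *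
    Complex.exp (Complex.I * ((inner ℝ x ξ + t / (2 * n) : ℝ) : ℂ))

/-- The X-ray transform of `β` along the line through `x` with direction `θ`. -/
def xray {d : ℕ} (β : E d → ℝ) (x θ : E d) : ℝ :=
  ∫ τ : ℝ, β (x + τ • θ)

end HigherNLS

end

/-! Everything is transported to the Fourier side, to `L1 d`. By the convolution theorem `FL¹` is a
Banach algebra, and every Fourier multiplier `exp(itq)` with `q` real and continuous is an isometry
of `L1 d`. The nonlinearity becomes `nonlin`, a multiplication operator composed with a power series
in the multiplication operator `absSqOp f`. It vanishes at `0` and on the ball of radius `r` is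
Lipschitz with constant `O(r²)` (`norm_nonlin_sub_le`). Picard iteration in the interaction picture
gives a small solution (`exists_mild`). A first-exit argument shows that any other solution stays in
the same ball (`mild_norm_lt`), so uniqueness holds in the whole class (`mild_unique`).

The dilation `x ↦ εx` preserves the `FL¹` norm, so the packet has size `O(ε^p)` and one may take `r`
comparable to `ε^p`. Three comparisons then give the error. The Duhamel term is `O(r³) = O(ε^{3p})`.
The nonlinear phase of the packet is multiplication by the exponential of an operator of norm
`O(ε^{2p})`, so removing it also costs `O(ε^{3p})` (`exists_wavePacket_hat`). The packet without
this phase is a transported profile whose frequencies sit at scale `ε` around `ξ`; replacing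
`|y|^{2n}/2n` by its tangent at `ξ` costs `O(ε²)` relative to `ε^p`
(`norm_propagator_sub_linearPacket_le`). The resulting bound `O(ε^{p+2} + ε^{3p})` is stronger than
the one claimed.

The X-ray statement is separate: a change of variables (`wavePacket_eq`) turns the phase into an
integral of `β` along a segment that contains all of its support on that line (`integral_eq_xray`).
-/

noncomputable section

namespace HigherNLS

open Filter Topology FourierTransform

variable {d : ℕ}

/-! ### The inverse Fourier transform on `L¹` -/

/-- The normalising constant `(2π)^(-d/2)`. -/
def fourierConst (d : ℕ) : ℝ := (2 * Real.pi) ^ (-(d : ℝ) / 2)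

theorem fourierConst_pos (d : ℕ) : 0 < fourierConst d :=
  Real.rpow_pos_of_pos (by positivity) _

theorem fourierConst_le_one (d : ℕ) : fourierConst d ≤ 1 := by
  refine Real.rpow_le_one_of_one_le_of_nonpos ?_ ?_
  · nlinarith [Real.pi_gt_three]
  · have : (0 : ℝ) ≤ d := Nat.cast_nonneg d
    linarith

theorem norm_exp_I_mul (r : ℝ) : ‖Complex.exp (Complex.I * (r : ℂ))‖ = 1 := by
  rw [mul_comm, Complex.norm_exp_ofReal_mul_I]

theorem invFourier_eq_fourier (f : E d → ℂ) (x : E d) :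
    invFourier f x = fourierConst d * 𝓕 f (-(2 * Real.pi)⁻¹ • x) := by
  rw [Real.fourier_eq', invFourier]
  congr 1
  refine integral_congr_ae (Eventually.of_forall fun y => ?_)
  simp only [smul_eq_mul]
  congr 2
  rw [mul_comm]
  congr 2
  rw [inner_smul_right, real_inner_comm]
  field_simp

theorem invFourier_congr {f g : E d → ℂ} (h : f =ᵐ[volume] g) (x : E d) :
    invFourier f x = invFourier g x := by
  rw [invFourier, invFourier]
  congr 1
  refine integral_congr_ae ?_
  filter_upwards [h] with y hy
  rw [hy]

theorem integrable_exp_mul {f : E d → ℂ} (hf : Integrable f) {q : E d → ℝ} (hq : Continuous q) :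
    Integrable (fun y => Complex.exp (Complex.I * (q y : ℂ)) * f y) := by
  refine hf.bdd_mul (c := 1) ?_ ?_
  · have : Continuous (fun y => Complex.exp (Complex.I * (q y : ℂ))) := by fun_prop
    exact this.aestronglyMeasurable
  · exact Eventually.of_forall fun y => (norm_exp_I_mul _).le

/-- Evaluation at `x` of the inverse Fourier transform, as a functional on `L¹`. -/
def evalCLM (x : E d) : L1 d →L[ℂ] ℂ :=
  LinearMap.mkContinuous
    { toFun := fun f => invFourier (fun y => f y) x
      map_add' := by
        intro f g
        rw [invFourier_congr (Lp.coeFn_add f g) x]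
        simp only [invFourier, Pi.add_apply, mul_add]
        rw [integral_add (integrable_exp_mul (L1.integrable_coeFn f) (by fun_prop))
          (integrable_exp_mul (L1.integrable_coeFn g) (by fun_prop)), mul_add]
      map_smul' := by
        intro c f
        rw [invFourier_congr (Lp.coeFn_smul c f) x]
        simp only [invFourier, Pi.smul_apply, smul_eq_mul, RingHom.id_apply]
        rw [mul_left_comm c, ← integral_const_mul c]
        congr 2
        funext y
        ring }
    1 (by
      intro f
      simp only [LinearMap.coe_mk, AddHom.coe_mk, invFourier, norm_mul]
      have h1 : ‖(((2 * Real.pi) ^ (-(d : ℝ) / 2) : ℝ) : ℂ)‖ ≤ 1 := by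
        rw [Complex.norm_real, Real.norm_of_nonneg (by positivity)]
        exact fourierConst_le_one d
      refine mul_le_mul h1 ?_ (norm_nonneg _) zero_le_one
      refine (norm_integral_le_integral_norm _).trans ?_
      rw [L1.norm_eq_integral_norm]
      simp only [norm_mul, norm_exp_I_mul, one_mul, le_refl])

theorem evalCLM_apply (x : E d) (f : L1 d) : evalCLM x f = invFourier (fun y => f y) x := rfl

theorem norm_evalCLM_apply_le (x : E d) (f : L1 d) : ‖evalCLM x f‖ ≤ ‖f‖ := by
  simpa using LinearMap.mkContinuous_norm_le _ zero_le_one _ |> fun h =>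
    ((evalCLM x).le_of_opNorm_le h f)

theorem evalCLM_toL1 (x : E d) {f : E d → ℂ} (hf : Integrable f) :
    evalCLM x (hf.toL1 f) = invFourier f x :=
  invFourier_congr hf.coeFn_toL1 x

/-- The Fourier transform is injective on `L¹`. -/
theorem ae_eq_zero_of_fourier_eq_zero {f : E d → ℂ} (hf : Integrable f) (h : ∀ w, 𝓕 f w = 0) :
    ∀ᵐ x, f x = 0 := by
  refine ae_eq_zero_of_integral_contDiff_smul_eq_zero hf.locallyIntegrable fun g hg hgc => ?_
  have hg₁ : HasCompactSupport (Complex.ofRealCLM ∘ g) := hgc.comp_left rfl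
  have hg₂ : ContDiff ℝ (⊤ : ℕ∞) (Complex.ofRealCLM ∘ g) := by fun_prop
  -- A test function is the transform of a Schwartz function `φ`, so moving the transform across the
  -- pairing gives `∫ g f = ∫ φ 𝓕f = 0`.
  set ψ : SchwartzMap (E d) ℂ := hg₁.toSchwartzMap hg₂ with hψ
  set φ : SchwartzMap (E d) ℂ := 𝓕⁻ ψ with hφ
  have h1 : (𝓕 (φ : E d → ℂ)) = fun x => ((g x : ℝ) : ℂ) := by
    rw [← SchwartzMap.fourier_coe, hφ, FourierTransform.fourier_fourierInv_eq]
    rfl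
  have h2 := VectorFourier.integral_fourierIntegral_smul_eq_flip (μ := (volume : Measure (E d)))
    (ν := (volume : Measure (E d)))
    (L := innerₗ (E d)) (f := (φ : E d → ℂ)) (g := f) Real.continuous_fourierChar
    continuous_inner φ.integrable hf
  have h3 : ∀ x, VectorFourier.fourierIntegral Real.fourierChar volume (innerₗ (E d)).flip f x
      = 0 := by
    intro x
    rw [flip_innerₗ]
    exact h x
  simp only [h3, smul_zero, integral_zero] at h2
  rw [← h2]
  refine integral_congr_ae (Eventually.of_forall fun x => ?_)
  have h4 : VectorFourier.fourierIntegral Real.fourierChar volume (innerₗ (E d)) (φ : E d → ℂ) x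
      = ((g x : ℝ) : ℂ) := congrFun h1 x
  simp only [h4, smul_eq_mul, Complex.real_smul]

/-- Injectivity of the transform: identities in `L1 d`, such as bilinearity of the convolution, can
be checked pointwise on the physical side. -/
theorem eq_of_evalCLM_eq {f g : L1 d} (h : ∀ x, evalCLM x f = evalCLM x g) : f = g := by
  rw [← sub_eq_zero]
  rw [Lp.eq_zero_iff_ae_eq_zero]
  refine ae_eq_zero_of_fourier_eq_zero (L1.integrable_coeFn _) fun w => ?_
  have h1 : evalCLM (-(2 * Real.pi) • w) (f - g) = 0 := by
    rw [map_sub, h, sub_self]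
  rw [evalCLM_apply, invFourier_eq_fourier, smul_smul] at h1
  have h2 : -(2 * Real.pi)⁻¹ * -(2 * Real.pi) = 1 := by
    field_simp
  rw [h2, one_smul] at h1
  exact (mul_eq_zero.1 h1).resolve_left (by exact_mod_cast (fourierConst_pos d).ne')

theorem memFL1_eval (f : L1 d) : MemFL1 (fun x => evalCLM x f) := ⟨f, fun _ => rfl⟩

theorem evalCLM_fourierFL1 {w : E d → ℂ} (hw : MemFL1 w) (x : E d) :
    evalCLM x (fourierFL1 w) = w x := by
  rw [fourierFL1, dif_pos hw, hw.choose_spec x]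
  rfl

/-- By injectivity the choice made in `fourierFL1` does not matter. -/
theorem fourierFL1_eq {w : E d → ℂ} {f : L1 d} (h : ∀ x, w x = evalCLM x f) :
    fourierFL1 w = f :=
  eq_of_evalCLM_eq fun x => by rw [evalCLM_fourierFL1 ⟨f, h⟩, h]

theorem normFL1_eq {w : E d → ℂ} {f : L1 d} (h : ∀ x, w x = evalCLM x f) :
    normFL1 w = ‖f‖ₑ := by
  rw [normFL1, if_pos ⟨f, h⟩, fourierFL1_eq h]

/-! ### Multiplication operators -/

open Convolution in
/-- Normalised convolution, the Fourier transform of a product. -/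
def convL1 (f g : L1 d) : L1 d :=
  (fourierConst d : ℂ) • ((L1.integrable_coeFn f).integrable_convolution
    (ContinuousLinearMap.mul ℂ ℂ) (L1.integrable_coeFn g)).toL1 _

theorem evalCLM_convL1 (f g : L1 d) (x : E d) :
    evalCLM x (convL1 f g) = evalCLM x f * evalCLM x g := by
  rw [convL1, map_smul, evalCLM_toL1, evalCLM_apply, evalCLM_apply]
  simp only [invFourier_eq_fourier, smul_eq_mul]
  rw [Real.fourier_mul_convolution_eq (L1.integrable_coeFn f) (L1.integrable_coeFn g)]
  ring

open Convolution in
theorem norm_convL1_le (f g : L1 d) : ‖convL1 f g‖ ≤ ‖f‖ * ‖g‖ := by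
  have hf := L1.integrable_coeFn f
  have hg := L1.integrable_coeFn g
  rw [convL1, norm_smul, Complex.norm_real, Real.norm_of_nonneg (fourierConst_pos d).le]
  refine (mul_le_of_le_one_left (norm_nonneg _) (fourierConst_le_one d)).trans ?_
  rw [L1.norm_of_fun_eq_integral_norm, L1.norm_eq_integral_norm, L1.norm_eq_integral_norm]
  have h1 := integral_convolution (μ := (volume : Measure (E d))) (ν := volume)
    (ContinuousLinearMap.mul ℝ ℝ) hf.norm hg.norm
  rw [ContinuousLinearMap.mul_apply'] at h1
  rw [← h1]
  refine integral_mono_ae (hf.integrable_convolution _ hg).norm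
    (hf.norm.integrable_convolution _ hg.norm) (Eventually.of_forall fun x => ?_)
  simp only [convolution_def]
  refine (norm_integral_le_integral_norm _).trans (le_of_eq ?_)
  simp

/-- Multiplication by `𝓕⁻¹ f` on the Fourier side, as an operator on `L¹`. -/
def mulOp (d : ℕ) : L1 d →L[ℂ] L1 d →L[ℂ] L1 d :=
  LinearMap.mkContinuous₂
    (LinearMap.mk₂ ℂ convL1
      (fun f f' g => eq_of_evalCLM_eq fun x => by simp only [evalCLM_convL1, map_add, add_mul])
      (fun c f g => eq_of_evalCLM_eq fun x => by
        simp only [evalCLM_convL1, map_smul, smul_eq_mul, mul_assoc])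
      (fun f g g' => eq_of_evalCLM_eq fun x => by simp only [evalCLM_convL1, map_add, mul_add])
      (fun c f g => eq_of_evalCLM_eq fun x => by
        simp only [evalCLM_convL1, map_smul, smul_eq_mul, mul_left_comm]))
    1 (fun f g => by simpa using norm_convL1_le f g)

theorem norm_mulOp_le (f : L1 d) : ‖mulOp d f‖ ≤ ‖f‖ := by
  refine ((mulOp d).le_of_opNorm_le (LinearMap.mkContinuous₂_norm_le _ zero_le_one _) f).trans ?_
  rw [one_mul]

/-- The operator `M` on `L¹` is, on the physical side, multiplication by the function `m`. -/
def IsMultiplier (M : L1 d →L[ℂ] L1 d) (m : E d → ℂ) : Prop :=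
  ∀ f x, evalCLM x (M f) = m x * evalCLM x f

theorem isMultiplier_mulOp (f : L1 d) : IsMultiplier (mulOp d f) fun x => evalCLM x f :=
  fun g x => evalCLM_convL1 f g x

theorem isMultiplier_one : IsMultiplier (1 : L1 d →L[ℂ] L1 d) fun _ => 1 := fun f x => by simp

theorem IsMultiplier.mul {M N : L1 d →L[ℂ] L1 d} {m n : E d → ℂ} (hM : IsMultiplier M m)
    (hN : IsMultiplier N n) : IsMultiplier (M * N) fun x => m x * n x := fun f x => by
  rw [mul_apply_eq_comp, hM, hN, mul_assoc]

theorem IsMultiplier.smul {M : L1 d →L[ℂ] L1 d} {m : E d → ℂ} (hM : IsMultiplier M m) (c : ℂ) :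
    IsMultiplier (c • M) fun x => c * m x := fun f x => by
  rw [smul_apply, map_smul, hM, smul_eq_mul, mul_assoc]

theorem IsMultiplier.pow {M : L1 d →L[ℂ] L1 d} {m : E d → ℂ} (hM : IsMultiplier M m) (k : ℕ) :
    IsMultiplier (M ^ k) fun x => m x ^ k := by
  induction k with
  | zero => simpa using isMultiplier_one
  | succ k ih => simpa only [pow_succ] using ih.mul hM

/-- Evaluation at a point is a continuous functional, so an operator series can be summed pointwise.
This identifies `G(|w|²)` and the exponential phase with operators. -/
theorem IsMultiplier.hasSum {ι : Type*} {M : ι → L1 d →L[ℂ] L1 d} {S : L1 d →L[ℂ] L1 d}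
    {m : ι → E d → ℂ} {s : E d → ℂ} (hM : ∀ i, IsMultiplier (M i) (m i)) (hS : HasSum M S)
    (hs : ∀ x, HasSum (fun i => m i x) (s x)) : IsMultiplier S s := by
  intro f x
  have h1 : HasSum (fun i => evalCLM x (M i f)) (evalCLM x (S f)) :=
    (hS.mapL (ContinuousLinearMap.apply ℂ (L1 d) f)).mapL (evalCLM x)
  refine h1.unique ?_
  simp only [fun i => hM i f x]
  exact (hs x).mul_right _

theorem IsMultiplier.exp {M : L1 d →L[ℂ] L1 d} {m : E d → ℂ} (hM : IsMultiplier M m) :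
    IsMultiplier (NormedSpace.exp M) fun x => Complex.exp (m x) := by
  refine IsMultiplier.hasSum (fun k => (hM.pow k).smul ((k.factorial : ℂ)⁻¹))
    (NormedSpace.exp_series_hasSum_exp' (𝕂 := ℂ) M) fun x => ?_
  rw [Complex.exp_eq_exp_ℂ]
  exact NormedSpace.exp_series_hasSum_exp' (𝕂 := ℂ) (m x)

/-! ### Complex conjugation -/

theorem integrable_conj_neg (f : L1 d) :
    Integrable (fun y : E d => (starRingEnd ℂ) (f (-y))) := by
  have := (L1.integrable_coeFn f).comp_neg
  exact (integrable_norm_iff (Complex.continuous_conj.comp_aestronglyMeasurable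
    this.aestronglyMeasurable)).1 (by simpa using this.norm)

/-- Complex conjugation on the Fourier side. -/
def conjL1 (f : L1 d) : L1 d := (integrable_conj_neg f).toL1 _

theorem evalCLM_conjL1 (f : L1 d) (x : E d) :
    evalCLM x (conjL1 f) = (starRingEnd ℂ) (evalCLM x f) := by
  rw [conjL1, evalCLM_toL1, evalCLM_apply, invFourier, invFourier, map_mul, Complex.conj_ofReal,
    ← integral_conj, ← integral_neg_eq_self]
  congr 2
  funext y
  rw [map_mul, ← Complex.exp_conj, map_mul, Complex.conj_I, Complex.conj_ofReal, inner_neg_right,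
    neg_neg]
  simp

theorem norm_conjL1 (f : L1 d) : ‖conjL1 f‖ = ‖f‖ := by
  rw [conjL1, L1.norm_of_fun_eq_integral_norm, L1.norm_eq_integral_norm]
  simp only [RCLike.norm_conj]
  exact integral_neg_eq_self (fun y => ‖f y‖) volume

theorem conjL1_sub (f g : L1 d) : conjL1 (f - g) = conjL1 f - conjL1 g :=
  eq_of_evalCLM_eq fun x => by simp only [evalCLM_conjL1, map_sub]

/-! ### Unimodular multipliers on the Fourier side -/

theorem integrable_phase (q : C(E d, ℝ)) (t : ℝ) (f : L1 d) :
    Integrable (fun y => Complex.exp (Complex.I * ((t * q y : ℝ) : ℂ)) * f y) :=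
  integrable_exp_mul (L1.integrable_coeFn f) (q := fun y => t * q y) (by fun_prop)

/-- Multiplication by `exp (i t q)` on `L¹`. -/
def phase (q : C(E d, ℝ)) (t : ℝ) : L1 d →ₗᵢ[ℂ] L1 d where
  toFun f := (integrable_phase q t f).toL1 _
  map_add' f g := by
    rw [← Integrable.toL1_add, Integrable.toL1_eq_toL1_iff]
    filter_upwards [Lp.coeFn_add f g] with y hy
    simp only [hy, Pi.add_apply, mul_add]
  map_smul' c f := by
    rw [RingHom.id_apply, ← Integrable.toL1_smul, Integrable.toL1_eq_toL1_iff]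
    filter_upwards [Lp.coeFn_smul c f] with y hy
    simp only [hy, Pi.smul_apply, smul_eq_mul]
    ring
  norm_map' f := by
    simp only [LinearMap.coe_mk, AddHom.coe_mk]
    rw [L1.norm_of_fun_eq_integral_norm, L1.norm_eq_integral_norm]
    simp only [norm_mul, norm_exp_I_mul, one_mul]

theorem coeFn_phase (q : C(E d, ℝ)) (t : ℝ) (f : L1 d) :
    phase q t f =ᵐ[volume] fun y => Complex.exp (Complex.I * ((t * q y : ℝ) : ℂ)) * f y :=
  (integrable_phase q t f).coeFn_toL1

theorem phase_add (q : C(E d, ℝ)) (s t : ℝ) (f : L1 d) :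
    phase q (s + t) f = phase q s (phase q t f) := by
  refine Lp.ext ?_
  filter_upwards [coeFn_phase q (s + t) f, coeFn_phase q s (phase q t f), coeFn_phase q t f]
    with y h1 h2 h3
  rw [h1, h2, h3, ← mul_assoc, ← Complex.exp_add]
  congr 2
  push_cast
  ring

theorem phase_zero (q : C(E d, ℝ)) (f : L1 d) : phase q 0 f = f := by
  refine Lp.ext ?_
  filter_upwards [coeFn_phase q 0 f] with y h1
  rw [h1]
  simp

theorem norm_phase_sub_phase (q q' : C(E d, ℝ)) (s t : ℝ) (f : L1 d) :
    ‖phase q s f - phase q' t f‖ = ∫ y, ‖Complex.exp (Complex.I * ((s * q y : ℝ) : ℂ)) -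
      Complex.exp (Complex.I * ((t * q' y : ℝ) : ℂ))‖ * ‖f y‖ := by
  rw [L1.norm_eq_integral_norm]
  refine integral_congr_ae ?_
  filter_upwards [Lp.coeFn_sub (phase q s f) (phase q' t f), coeFn_phase q s f,
    coeFn_phase q' t f] with y h1 h2 h3
  rw [h1, Pi.sub_apply, h2, h3, ← sub_mul, norm_mul]

theorem continuous_phase_apply (q : C(E d, ℝ)) (f : L1 d) : Continuous fun t => phase q t f := by
  refine continuous_iff_continuousAt.2 fun t => ?_
  rw [ContinuousAt, tendsto_iff_norm_sub_tendsto_zero]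
  simp only [norm_phase_sub_phase]
  have h : Continuous fun s : ℝ => ∫ y, ‖Complex.exp (Complex.I * ((s * q y : ℝ) : ℂ)) -
      Complex.exp (Complex.I * ((t * q y : ℝ) : ℂ))‖ * ‖f y‖ := by
    refine continuous_of_dominated (bound := fun y => 2 * ‖f y‖) (fun s => ?_) (fun s => ?_) ?_ ?_
    · refine AEStronglyMeasurable.mul ?_ (L1.integrable_coeFn f).norm.aestronglyMeasurable
      exact Continuous.aestronglyMeasurable (by fun_prop)
    · refine Eventually.of_forall fun y => ?_
      rw [norm_mul, norm_norm, norm_norm]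
      refine mul_le_mul_of_nonneg_right ((norm_sub_le _ _).trans ?_) (norm_nonneg _)
      rw [norm_exp_I_mul, norm_exp_I_mul]
      norm_num
    · exact (L1.integrable_coeFn f).norm.const_mul 2
    · exact Eventually.of_forall fun y => by fun_prop
  simpa using h.tendsto t

/-- Strong continuity in time and the isometry property together give joint continuity; norm
continuity of the group is not needed. -/
theorem continuous_phase (q : C(E d, ℝ)) : Continuous fun z : ℝ × L1 d => phase q z.1 z.2 := by
  refine continuous_iff_continuousAt.2 fun z => ?_
  rw [ContinuousAt, tendsto_iff_norm_sub_tendsto_zero]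
  have h1 : Tendsto (fun w : ℝ × L1 d => ‖w.2 - z.2‖ + ‖phase q w.1 z.2 - phase q z.1 z.2‖)
      (𝓝 z) (𝓝 0) := by
    have : Continuous fun w : ℝ × L1 d => ‖w.2 - z.2‖ + ‖phase q w.1 z.2 - phase q z.1 z.2‖ :=
      (by fun_prop : Continuous fun w : ℝ × L1 d => ‖w.2 - z.2‖).add
        (((continuous_phase_apply q z.2).comp continuous_fst).sub continuous_const).norm
    simpa using this.tendsto z
  refine squeeze_zero (fun _ => norm_nonneg _) (fun w => ?_) h1
  have h2 : phase q w.1 w.2 - phase q z.1 z.2 =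
      phase q w.1 (w.2 - z.2) + (phase q w.1 z.2 - phase q z.1 z.2) := by
    rw [map_sub]
    abel
  rw [h2]
  refine (norm_add_le _ _).trans ?_
  rw [LinearIsometry.norm_map]

/-- The Fourier symbol of `(-Δ)ⁿ/2n`. -/
def dispersion (d n : ℕ) : C(E d, ℝ) := ⟨fun y => ‖y‖ ^ (2 * n) / (2 * n), by fun_prop⟩

theorem propagator_eq_phase (n : ℕ) (t : ℝ) (f : L1 d) :
    propagator n t f = phase (dispersion d n) t f := by
  refine Lp.ext ?_
  filter_upwards [(integrable_symbol_mul n t f).coeFn_toL1, coeFn_phase (dispersion d n) t f]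
    with y h1 h2
  rw [propagator, h1, h2, symbol, dispersion, ContinuousMap.coe_mk, mul_div_assoc]

theorem phase_comm (q q' : C(E d, ℝ)) (s t : ℝ) (f : L1 d) :
    phase q s (phase q' t f) = phase q' t (phase q s f) := by
  refine Lp.ext ?_
  filter_upwards [coeFn_phase q s (phase q' t f), coeFn_phase q' t (phase q s f),
    coeFn_phase q s f, coeFn_phase q' t f] with y h1 h2 h3 h4
  rw [h1, h2, h3, h4, mul_left_comm]

/-- The symbol `c + ξ · y` of a translation in direction `ξ` combined with a change of phase. -/
def affineSymbol (c : ℝ) (ξ : E d) : C(E d, ℝ) := ⟨fun y => c + inner ℝ ξ y, by fun_prop⟩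

theorem evalCLM_phase_affineSymbol (c : ℝ) (ξ : E d) (t : ℝ) (f : L1 d) (x : E d) :
    evalCLM x (phase (affineSymbol c ξ) t f) =
      Complex.exp (Complex.I * ((t * c : ℝ) : ℂ)) * evalCLM (x + t • ξ) f := by
  rw [evalCLM_apply, invFourier_congr (coeFn_phase (affineSymbol c ξ) t f), evalCLM_apply,
    invFourier, invFourier, mul_left_comm,
    ← integral_const_mul (Complex.exp (Complex.I * ((t * c : ℝ) : ℂ)))]
  congr 2
  funext y
  rw [← mul_assoc, ← mul_assoc, ← Complex.exp_add, ← Complex.exp_add, ← mul_add, ← mul_add,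
    ← Complex.ofReal_add, ← Complex.ofReal_add, affineSymbol, ContinuousMap.coe_mk,
    inner_add_left, real_inner_smul_left]
  congr 4
  ring

/-! ### Power series without constant term in a Banach algebra -/

section PowSeries

variable {𝔸 : Type*} [NormedRing 𝔸]

/-- Telescoping that keeps the order of the factors, since the algebra need not be commutative. -/
theorem norm_pow_succ_sub_pow_succ_le {P Q : 𝔸} {ρ : ℝ} (hP : ‖P‖ ≤ ρ) (hQ : ‖Q‖ ≤ ρ) (k : ℕ) :
    ‖P ^ (k + 1) - Q ^ (k + 1)‖ ≤ (k + 1) * ρ ^ k * ‖P - Q‖ := by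
  have hρ : 0 ≤ ρ := (norm_nonneg P).trans hP
  induction k with
  | zero => simp
  | succ k ih =>
    have h1 : P ^ (k + 2) - Q ^ (k + 2) = P ^ (k + 1) * (P - Q) + (P ^ (k + 1) - Q ^ (k + 1)) * Q := by
      rw [pow_succ P (k + 1), pow_succ Q (k + 1)]
      noncomm_ring
    rw [h1]
    have h2 : ‖P ^ (k + 1)‖ ≤ ρ ^ (k + 1) :=
      (norm_pow_le' P k.succ_pos).trans (pow_le_pow_left₀ (norm_nonneg _) hP _)
    calc _ ≤ ‖P ^ (k + 1)‖ * ‖P - Q‖ + ‖P ^ (k + 1) - Q ^ (k + 1)‖ * ‖Q‖ :=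
          (norm_add_le _ _).trans (add_le_add (norm_mul_le _ _) (norm_mul_le _ _))
      _ ≤ ρ ^ (k + 1) * ‖P - Q‖ + ((k + 1) * ρ ^ k * ‖P - Q‖) * ρ := by gcongr
      _ = _ := by push_cast; ring

/-- From `k + 1 ≤ 2^k`: halving the radius absorbs the factor produced by differentiating the
series, so one summability condition serves both the size and the Lipschitz bounds. -/
theorem succ_mul_half_pow_le (k : ℕ) {ρ : ℝ} (hρ : 0 ≤ ρ) :
    ((k : ℝ) + 1) * (ρ / 2) ^ k ≤ ρ ^ k := by
  rw [div_pow, mul_div_assoc', div_le_iff₀ (by positivity), mul_comm]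
  refine mul_le_mul_of_nonneg_left ?_ (by positivity)
  exact_mod_cast Nat.lt_two_pow_self (n := k)

variable [NormedAlgebra ℂ 𝔸]

/-- The power series `∑ bₖ P^(k+1)`. -/
def powSeries (b : ℕ → ℂ) (P : 𝔸) : 𝔸 := ∑' k, b k • P ^ (k + 1)

theorem powSeries_zero (b : ℕ → ℂ) : powSeries b (0 : 𝔸) = 0 := by
  simp [powSeries]

variable [CompleteSpace 𝔸] {b : ℕ → ℂ} {ρ : ℝ}

theorem hasSum_powSeries (hρ : 0 ≤ ρ) (hb : Summable fun k => ‖b k‖ * ρ ^ k) {P : 𝔸}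
    (hP : ‖P‖ ≤ ρ / 2) : HasSum (fun k => b k • P ^ (k + 1)) (powSeries b P) := by
  refine Summable.hasSum (Summable.of_norm_bounded (hb.mul_right ρ) fun k => ?_)
  rw [norm_smul, mul_assoc, ← pow_succ]
  refine mul_le_mul_of_nonneg_left ?_ (norm_nonneg _)
  exact (norm_pow_le' P k.succ_pos).trans
    (pow_le_pow_left₀ (norm_nonneg _) (hP.trans (by linarith)) _)

theorem norm_powSeries_sub_le (hρ : 0 ≤ ρ) (hb : Summable fun k => ‖b k‖ * ρ ^ k) {P Q : 𝔸}
    (hP : ‖P‖ ≤ ρ / 2) (hQ : ‖Q‖ ≤ ρ / 2) :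
    ‖powSeries b P - powSeries b Q‖ ≤ (∑' k, ‖b k‖ * ρ ^ k) * ‖P - Q‖ := by
  have h1 := (hasSum_powSeries hρ hb hP).sub (hasSum_powSeries hρ hb hQ)
  rw [← h1.tsum_eq]
  refine tsum_of_norm_bounded (hb.hasSum.mul_right ‖P - Q‖) fun k => ?_
  rw [← smul_sub, norm_smul, mul_assoc]
  refine mul_le_mul_of_nonneg_left ?_ (norm_nonneg _)
  refine (norm_pow_succ_sub_pow_succ_le hP hQ k).trans ?_
  exact mul_le_mul_of_nonneg_right (succ_mul_half_pow_le k hρ) (norm_nonneg _)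

theorem norm_powSeries_le (hρ : 0 ≤ ρ) (hb : Summable fun k => ‖b k‖ * ρ ^ k) {P : 𝔸}
    (hP : ‖P‖ ≤ ρ / 2) : ‖powSeries b P‖ ≤ (∑' k, ‖b k‖ * ρ ^ k) * ‖P‖ := by
  simpa [powSeries_zero] using norm_powSeries_sub_le hρ hb hP (Q := 0) (by rw [norm_zero]; linarith)

theorem norm_exp_sub_one_le_of_norm_le_one {P : 𝔸} (hP : ‖P‖ ≤ 1) :
    ‖NormedSpace.exp P - 1‖ ≤ 2 * ‖P‖ := by
  have h1 := (hasSum_nat_add_iff' 1).2 (NormedSpace.exp_series_hasSum_exp' (𝕂 := ℂ) P)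
  have h2 := (hasSum_nat_add_iff' 1).2
    (NormedSpace.exp_series_hasSum_exp' (𝕂 := ℝ) (‖P‖ : ℝ))
  simp only [Finset.range_one, Finset.sum_singleton, Nat.factorial_zero, Nat.cast_one, inv_one,
    pow_zero, one_smul] at h1 h2
  have h3 : ‖NormedSpace.exp P - 1‖ ≤ NormedSpace.exp ‖P‖ - 1 := by
    rw [← h1.tsum_eq]
    refine tsum_of_norm_bounded h2 fun k => ?_
    rw [norm_smul, norm_inv, Complex.norm_natCast, smul_eq_mul]
    exact mul_le_mul_of_nonneg_left (norm_pow_le' P k.succ_pos) (by positivity)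
  refine h3.trans ?_
  rw [← Real.exp_eq_exp_ℝ]
  have h4 := Real.abs_exp_sub_one_le (x := ‖P‖) (by rwa [abs_norm])
  rw [abs_norm] at h4
  exact (le_abs_self _).trans h4

end PowSeries

/-! ### The nonlinearity on the Fourier side -/

/-- Multiplication by `|𝓕⁻¹ f|²`. -/
def absSqOp (f : L1 d) : L1 d →L[ℂ] L1 d := mulOp d f * mulOp d (conjL1 f)

theorem isMultiplier_absSqOp (f : L1 d) :
    IsMultiplier (absSqOp f) fun x => ((‖evalCLM x f‖ ^ 2 : ℝ) : ℂ) := by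
  have h := (isMultiplier_mulOp f).mul (isMultiplier_mulOp (conjL1 f))
  simp only [evalCLM_conjL1, Complex.mul_conj'] at h
  exact_mod_cast h

theorem norm_absSqOp_le (f : L1 d) : ‖absSqOp f‖ ≤ ‖f‖ ^ 2 := by
  rw [sq]
  refine (norm_mul_le _ _).trans (mul_le_mul (norm_mulOp_le f) ?_ (norm_nonneg _) (norm_nonneg _))
  rw [← norm_conjL1 f]
  exact norm_mulOp_le _

theorem norm_absSqOp_sub_le {f g : L1 d} {r : ℝ} (hf : ‖f‖ ≤ r) (hg : ‖g‖ ≤ r) :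
    ‖absSqOp f - absSqOp g‖ ≤ 2 * r * ‖f - g‖ := by
  have h1 : absSqOp f - absSqOp g = mulOp d f * mulOp d (conjL1 (f - g)) +
      mulOp d (f - g) * mulOp d (conjL1 g) := by
    rw [absSqOp, absSqOp, conjL1_sub, map_sub, map_sub]
    noncomm_ring
  have hr : 0 ≤ r := (norm_nonneg f).trans hf
  rw [h1]
  calc _ ≤ ‖mulOp d f‖ * ‖mulOp d (conjL1 (f - g))‖ + ‖mulOp d (f - g)‖ * ‖mulOp d (conjL1 g)‖ :=
        (norm_add_le _ _).trans (add_le_add (norm_mul_le _ _) (norm_mul_le _ _))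
    _ ≤ r * ‖f - g‖ + ‖f - g‖ * r := by
        gcongr
        · exact (norm_mulOp_le f).trans hf
        · exact (norm_mulOp_le _).trans (norm_conjL1 _).le
        · exact norm_mulOp_le _
        · exact (norm_mulOp_le _).trans ((norm_conjL1 _).le.trans hg)
    _ = _ := by ring

/-- The nonlinearity on the Fourier side, for `G(x) = ∑ bₖ x^(k+1)` and `β = 𝓕⁻¹ g`. -/
def nonlin (b : ℕ → ℂ) (g f : L1 d) : L1 d := mulOp d g (powSeries b (absSqOp f) f)

theorem nonlin_zero (b : ℕ → ℂ) (g : L1 d) : nonlin b g 0 = 0 := by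
  rw [nonlin, map_zero, map_zero]

variable {b : ℕ → ℂ} {ρ : ℝ}

/-- As `G` has no constant term, the nonlinearity is at least cubic, whence the factor `r²`. In the
constant `3`, two units come from varying `|w|²` and one from varying the last factor `w`. -/
theorem norm_nonlin_sub_le (hρ : 0 ≤ ρ) (hb : Summable fun k => ‖b k‖ * ρ ^ k) (g : L1 d)
    {r : ℝ} (hr : r ^ 2 ≤ ρ / 2) {f f' : L1 d} (hf : ‖f‖ ≤ r) (hf' : ‖f'‖ ≤ r) :
    ‖nonlin b g f - nonlin b g f'‖ ≤
      3 * ‖g‖ * (∑' k, ‖b k‖ * ρ ^ k) * r ^ 2 * ‖f - f'‖ := by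
  have hr0 : 0 ≤ r := (norm_nonneg f).trans hf
  have h0 : ∀ h : L1 d, ‖h‖ ≤ r → ‖absSqOp h‖ ≤ r ^ 2 := fun h hh =>
    (norm_absSqOp_le h).trans (pow_le_pow_left₀ (norm_nonneg _) hh 2)
  set K := ∑' k, ‖b k‖ * ρ ^ k with hK
  have hK0 : 0 ≤ K := tsum_nonneg fun k => by positivity
  have h1 : nonlin b g f - nonlin b g f' = mulOp d g
      ((powSeries b (absSqOp f) - powSeries b (absSqOp f')) f +
        powSeries b (absSqOp f') (f - f')) := by
    simp only [nonlin, sub_apply, map_add, map_sub]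
    abel
  have h2 : ‖powSeries b (absSqOp f) - powSeries b (absSqOp f')‖ ≤ K * (2 * r * ‖f - f'‖) :=
    (norm_powSeries_sub_le hρ hb ((h0 f hf).trans hr) ((h0 f' hf').trans hr)).trans
      (mul_le_mul_of_nonneg_left (norm_absSqOp_sub_le hf hf') hK0)
  have h3 : ‖powSeries b (absSqOp f')‖ ≤ K * r ^ 2 :=
    (norm_powSeries_le hρ hb ((h0 f' hf').trans hr)).trans
      (mul_le_mul_of_nonneg_left (h0 f' hf') hK0)
  rw [h1]
  calc _ ≤ ‖g‖ * (‖powSeries b (absSqOp f) - powSeries b (absSqOp f')‖ * ‖f‖ +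
        ‖powSeries b (absSqOp f')‖ * ‖f - f'‖) := by
        refine (ContinuousLinearMap.le_of_opNorm_le _ (norm_mulOp_le g) _).trans ?_
        gcongr
        exact (norm_add_le _ _).trans (add_le_add (ContinuousLinearMap.le_opNorm _ _)
          (ContinuousLinearMap.le_opNorm _ _))
    _ ≤ ‖g‖ * (K * (2 * r * ‖f - f'‖) * r + K * r ^ 2 * ‖f - f'‖) := by gcongr
    _ = _ := by ring

/-- `G(|𝓕⁻¹ f|²)` is given by the power series of the multiplication operator. -/
theorem isMultiplier_powSeries_absSqOp {G : ℝ≥0 → ℝ≥0} (hρ : 0 < ρ) {b : ℕ → ℝ}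
    (hG : ∀ x : ℝ≥0, (x : ℝ) < 2 * ρ → HasSum (fun k => b k * (x : ℝ) ^ (k + 1)) (G x : ℝ))
    (hb : Summable fun k => ‖(b k : ℂ)‖ * ρ ^ k) {f : L1 d} (hf : ‖f‖ ^ 2 ≤ ρ / 2) :
    IsMultiplier (powSeries (fun k => (b k : ℂ)) (absSqOp f))
      fun x => ((G (‖evalCLM x f‖₊ ^ 2) : ℝ) : ℂ) := by
  refine IsMultiplier.hasSum (fun k => ((isMultiplier_absSqOp f).pow (k + 1)).smul (b k : ℂ))
    (hasSum_powSeries hρ.le hb ((norm_absSqOp_le f).trans hf)) fun x => ?_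
  have h1 : ((‖evalCLM x f‖₊ ^ 2 : ℝ≥0) : ℝ) < 2 * ρ := by
    have h2 : ‖evalCLM x f‖ ^ 2 ≤ ‖f‖ ^ 2 :=
      pow_le_pow_left₀ (norm_nonneg _) (norm_evalCLM_apply_le x f) 2
    push_cast
    linarith
  have h3 := Complex.hasSum_ofReal.2 (hG _ h1)
  simpa using h3

theorem nonlinearity_eval {G : ℝ≥0 → ℝ≥0} {β : E d → ℝ} {g : L1 d}
    (hg : ∀ x, (β x : ℂ) = evalCLM x g) (hρ : 0 < ρ) {b : ℕ → ℝ}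
    (hG : ∀ x : ℝ≥0, (x : ℝ) < 2 * ρ → HasSum (fun k => b k * (x : ℝ) ^ (k + 1)) (G x : ℝ))
    (hb : Summable fun k => ‖(b k : ℂ)‖ * ρ ^ k) {f : L1 d} (hf : ‖f‖ ^ 2 ≤ ρ / 2) (x : E d) :
    nonlinearity G β (fun x => evalCLM x f) x = evalCLM x (nonlin (fun k => (b k : ℂ)) g f) := by
  rw [nonlin, isMultiplier_mulOp g, isMultiplier_powSeries_absSqOp hρ hG hb hf, nonlinearity,
    Complex.ofReal_mul, hg, mul_assoc]

/-! ### Mild solutions of semilinear equations -/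

section Mild

variable {q : C(E d, ℝ)} {N : L1 d → L1 d} {r ℓ T : ℝ} {f₀ : L1 d}

theorem continuousOn_of_ball_lipschitz
    (hN : ∀ f g, ‖f‖ ≤ r → ‖g‖ ≤ r → ‖N f - N g‖ ≤ ℓ * ‖f - g‖) :
    ContinuousOn N (Metric.closedBall 0 r) := by
  have : LipschitzOnWith ℓ.toNNReal N (Metric.closedBall 0 r) := by
    refine LipschitzOnWith.of_dist_le_mul fun f hf g hg => ?_
    rw [dist_eq_norm, dist_eq_norm]
    refine (hN f g (by simpa using hf) (by simpa using hg)).trans ?_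
    exact mul_le_mul_of_nonneg_right (Real.le_coe_toNNReal ℓ) (norm_nonneg _)
  exact this.continuousOn

theorem continuousOn_phase_comp
    (hN : ∀ f g, ‖f‖ ≤ r → ‖g‖ ≤ r → ‖N f - N g‖ ≤ ℓ * ‖f - g‖) {y : ℝ → L1 d} {I : Set ℝ}
    (hy : ContinuousOn y I) (hyr : ∀ t ∈ I, ‖y t‖ ≤ r) {τ : ℝ → ℝ} (hτ : Continuous τ) :
    ContinuousOn (fun s => phase q (τ s) (N (y s))) I := by
  have h0 : MapsTo y I (Metric.closedBall 0 r) := fun t ht => mem_closedBall_zero_iff.2 (hyr t ht)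
  have h1 : ContinuousOn (fun s => N (y s)) I := (continuousOn_of_ball_lipschitz hN).comp hy h0
  have h2 : ContinuousOn (fun s => (τ s, N (y s))) I := hτ.continuousOn.prodMk h1
  have h3 := (continuous_phase q).comp_continuousOn h2
  exact h3

theorem norm_le_of_ball_lipschitz
    (hN : ∀ f g, ‖f‖ ≤ r → ‖g‖ ≤ r → ‖N f - N g‖ ≤ ℓ * ‖f - g‖) (hN0 : N 0 = 0) (hℓ : 0 ≤ ℓ)
    {f : L1 d} (hf : ‖f‖ ≤ r) : ‖N f‖ ≤ ℓ * r := by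
  have h := hN f 0 hf (by simpa using (norm_nonneg f).trans hf)
  rw [hN0, sub_zero, sub_zero] at h
  exact h.trans (mul_le_mul_of_nonneg_left hf hℓ)

/-- Existence of a small mild solution. -/
theorem exists_mild (hT : 0 < T) (hr : 0 < r) (hℓ : 0 ≤ ℓ)
    (hN : ∀ f g, ‖f‖ ≤ r → ‖g‖ ≤ r → ‖N f - N g‖ ≤ ℓ * ‖f - g‖) (hN0 : N 0 = 0)
    (hf₀ : ‖f₀‖ ≤ r / 2) (hsmall : 2 * T * ℓ ≤ 1 / 4) :
    ∃ y : ℝ → L1 d, ContinuousOn y (Icc (-T) T) ∧ (∀ t ∈ Icc (-T) T, ‖y t‖ ≤ r) ∧ y (-T) = f₀ ∧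
      ∀ t ∈ Icc (-T) T, y t = phase q (t + T) f₀ -
        Complex.I • ∫ s in (-T)..t, phase q (t - s) (N (y s)) := by
  -- Interaction picture: conjugation by the isometric group removes the unbounded generator and
  -- leaves an ODE with Lipschitz right-hand side. Data of norm at most `r / 2` leave room for a
  -- ball of radius `r / 2` around `f₀`.
  set F : ℝ → L1 d → L1 d := fun t x => -Complex.I • phase q (-(t + T)) (N (phase q (t + T) x))
    with hF
  have hball : ∀ x ∈ Metric.closedBall f₀ (r / 2), ‖x‖ ≤ r := fun x hx => by
    have h1 : ‖x - f₀‖ ≤ r / 2 := by simpa [dist_eq_norm] using hx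
    have h2 := norm_sub_norm_le x f₀
    linarith
  have hmT : -T ∈ Icc (-T) T := left_mem_Icc.2 (by linarith)
  have hPL : IsPicardLindelof F (⟨-T, hmT⟩ : Icc (-T) T) f₀
      (NNReal.mk (r / 2) (by positivity)) 0 (NNReal.mk (ℓ * r) (by positivity))
      (NNReal.mk ℓ hℓ) := by
    refine ⟨fun t _ => LipschitzOnWith.of_dist_le_mul fun x hx y hy => ?_, fun x hx => ?_,
      fun t _ x hx => ?_, ?_⟩
    · rw [dist_eq_norm, dist_eq_norm, hF, NNReal.coe_mk]
      simp only
      rw [← smul_sub, norm_smul, norm_neg, Complex.norm_I, one_mul, ← map_sub,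
        LinearIsometry.norm_map]
      refine (hN _ _ ?_ ?_).trans ?_
      · rw [LinearIsometry.norm_map]; exact hball x hx
      · rw [LinearIsometry.norm_map]; exact hball y hy
      · rw [← map_sub, LinearIsometry.norm_map]
    · have hx' : Continuous fun t : ℝ => phase q (t + T) x := by
        have h1 := (continuous_phase_apply q x).comp (continuous_add_const T)
        exact h1
      have h1 := continuousOn_phase_comp (q := q) hN (hx'.continuousOn (s := Icc (-T) T))
        (fun t _ => by rw [LinearIsometry.norm_map]; exact hball x hx)
        (by fun_prop : Continuous fun t : ℝ => -(t + T))
      exact h1.const_smul (-Complex.I)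
    · rw [hF, NNReal.coe_mk]
      simp only
      rw [norm_smul, norm_neg, Complex.norm_I, one_mul, LinearIsometry.norm_map]
      refine norm_le_of_ball_lipschitz hN hN0 hℓ ?_
      rw [LinearIsometry.norm_map]; exact hball x hx
    · simp only [NNReal.coe_mk, NNReal.coe_zero, sub_neg_eq_add, sub_self]
      rw [max_eq_left (by linarith)]
      nlinarith
  have hx₀ : f₀ ∈ Metric.closedBall f₀ ((0 : ℝ≥0) : ℝ) := by simp
  obtain ⟨α, hα⟩ := ODE.FunSpace.exists_isFixedPt_next hPL hx₀
  set z := α.compProj with hz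
  have hzc : Continuous z := α.continuous_compProj
  have hzb : ∀ t, ‖z t‖ ≤ r := fun t =>
    hball _ (ODE.FunSpace.compProj_mem_closedBall α hPL.mul_max_le)
  have hzeq : ∀ t ∈ Icc (-T) T, z t = f₀ + ∫ s in (-T)..t, F s (z s) := fun t ht => by
    have h1 : z t = (ODE.FunSpace.next hPL hx₀ α).compProj t := by rw [hα]
    rw [h1, ODE.FunSpace.compProj_apply, ODE.FunSpace.next_apply, projIcc_of_mem _ ht,
      ODE.picard_apply]
  have hyc : Continuous fun t => phase q (t + T) (z t) := by
    have h1 : Continuous fun t : ℝ => (t + T, z t) := by fun_prop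
    have h2 := (continuous_phase q).comp h1
    exact h2
  have hyb : ∀ t, ‖phase q (t + T) (z t)‖ ≤ r := fun t => by
    rw [LinearIsometry.norm_map]; exact hzb t
  refine ⟨fun t => phase q (t + T) (z t), hyc.continuousOn, fun t _ => hyb t, ?_, fun t ht => ?_⟩
  · have := hzeq (-T) (by constructor <;> linarith)
    rw [intervalIntegral.integral_same, add_zero] at this
    simp only [neg_add_cancel, phase_zero, this]
  · have hFc : ContinuousOn (fun s => F s (z s)) (uIcc (-T) t) :=
      (continuousOn_phase_comp (q := q) hN hyc.continuousOn (fun t _ => hyb t)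
        (by fun_prop : Continuous fun t : ℝ => -(t + T))).const_smul (-Complex.I)
    have h1 := ((phase q (t + T)).toContinuousLinearMap).intervalIntegral_comp_comm
      (hFc.intervalIntegrable (μ := volume))
    simp only [LinearIsometry.coe_toContinuousLinearMap] at h1
    simp only
    rw [hzeq t ht, map_add, ← h1, sub_eq_add_neg, ← neg_smul, ← intervalIntegral.integral_smul]
    congr 1
    refine intervalIntegral.integral_congr fun s _ => ?_
    simp only [hF, map_smul]
    rw [← phase_add]
    congr 3
    ring

/-- A mild solution with small data stays in the ball where the nonlinearity is controlled. -/
theorem mild_norm_lt (hr : 0 < r) (hℓ : 0 ≤ ℓ)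
    (hN : ∀ f g, ‖f‖ ≤ r → ‖g‖ ≤ r → ‖N f - N g‖ ≤ ℓ * ‖f - g‖) (hN0 : N 0 = 0)
    (hf₀ : ‖f₀‖ ≤ r / 2) (hsmall : 2 * T * ℓ ≤ 1 / 4) {y h : ℝ → L1 d}
    (hy : ContinuousOn y (Icc (-T) T)) (hh : ∀ t ∈ Icc (-T) T, ‖y t‖ ≤ r → h t = N (y t))
    (hD : ∀ t ∈ Icc (-T) T, y t = phase q (t + T) f₀ -
        Complex.I • ∫ s in (-T)..t, phase q (t - s) (h s)) :
    ∀ t ∈ Icc (-T) T, ‖y t‖ < r := by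
  by_contra! hcon
  obtain ⟨t₀, ht₀, ht₀r⟩ := hcon
  -- Consider the first time the norm reaches `r`. Before it `h` equals `N ∘ y`, and Duhamel bounds
  -- the norm there by `r / 2 + r / 4 < r`.
  set A : Set ℝ := Icc (-T) T ∩ (fun t => ‖y t‖) ⁻¹' Ici r with hA
  have hAc : IsClosed A := hy.norm.preimage_isClosed_of_isClosed isClosed_Icc isClosed_Ici
  have hAb : BddBelow A := ⟨-T, fun t ht => ht.1.1⟩
  have hmem : sInf A ∈ A := hAc.csInf_mem ⟨t₀, ht₀, ht₀r⟩ hAb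
  set t₁ := sInf A with ht₁
  have hlt : ∀ t ∈ Icc (-T) T, t < t₁ → ‖y t‖ < r := fun t ht htt => by
    by_contra! hc
    exact absurd (csInf_le hAb (show t ∈ A from ⟨ht, hc⟩)) (not_le.2 htt)
  have hint : ‖∫ s in (-T)..t₁, phase q (t₁ - s) (h s)‖ ≤ ℓ * r * |t₁ - -T| := by
    refine intervalIntegral.norm_integral_le_of_norm_le_const_ae ?_
    -- At `t₁` itself the bound `‖y t₁‖ ≤ r` is not available, so this null set is discarded.
    have : ∀ᵐ s : ℝ, s ≠ t₁ := by simp [ae_iff, measure_singleton]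
    filter_upwards [this] with s hs hsm
    rw [uIoc_of_le hmem.1.1] at hsm
    have hsI : s ∈ Icc (-T) T := ⟨hsm.1.le, hsm.2.trans hmem.1.2⟩
    have hsr := (hlt s hsI (lt_of_le_of_ne hsm.2 hs)).le
    rw [LinearIsometry.norm_map, hh s hsI hsr]
    exact norm_le_of_ball_lipschitz hN hN0 hℓ hsr
  have h1 : ‖y t₁‖ ≤ ‖f₀‖ + ℓ * r * |t₁ - -T| := by
    rw [hD t₁ hmem.1]
    refine (norm_sub_le _ _).trans ?_
    rw [LinearIsometry.norm_map, norm_smul, Complex.norm_I, one_mul]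
    linarith
  have h2 : |t₁ - -T| ≤ 2 * T := by
    rw [abs_of_nonneg (by linarith [hmem.1.1])]
    linarith [hmem.1.2]
  have h3 : r ≤ ‖y t₁‖ := hmem.2
  have h4 : ℓ * r * |t₁ - -T| ≤ r / 4 := by
    have : ℓ * r * |t₁ - -T| ≤ ℓ * r * (2 * T) := mul_le_mul_of_nonneg_left h2 (by positivity)
    nlinarith
  linarith

/-- Two mild solutions in the ball coincide. -/
theorem mild_unique (hT : 0 < T) (hℓ : 0 ≤ ℓ)
    (hN : ∀ f g, ‖f‖ ≤ r → ‖g‖ ≤ r → ‖N f - N g‖ ≤ ℓ * ‖f - g‖)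
    (hsmall : 2 * T * ℓ ≤ 1 / 4) {y z : ℝ → L1 d}
    (hy : ContinuousOn y (Icc (-T) T)) (hyr : ∀ t ∈ Icc (-T) T, ‖y t‖ ≤ r)
    (hyD : ∀ t ∈ Icc (-T) T, y t = phase q (t + T) f₀ -
        Complex.I • ∫ s in (-T)..t, phase q (t - s) (N (y s)))
    (hz : ContinuousOn z (Icc (-T) T)) (hzr : ∀ t ∈ Icc (-T) T, ‖z t‖ ≤ r)
    (hzD : ∀ t ∈ Icc (-T) T, z t = phase q (t + T) f₀ -
        Complex.I • ∫ s in (-T)..t, phase q (t - s) (N (z s))) :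
    ∀ t ∈ Icc (-T) T, y t = z t := by
  -- At a maximum of `‖y - z‖`, Duhamel bounds this norm by a quarter of itself, so no Gronwall
  -- inequality is needed.
  obtain ⟨t₁, ht₁, hmax⟩ := isCompact_Icc.exists_isMaxOn
    (nonempty_Icc.2 (by linarith : -T ≤ T)) (hy.sub hz).norm
  have hmax' : ∀ t ∈ Icc (-T) T, ‖y t - z t‖ ≤ ‖y t₁ - z t₁‖ := fun t ht => hmax ht
  have hsub : uIcc (-T) t₁ ⊆ Icc (-T) T := by
    rw [uIcc_of_le ht₁.1]
    exact Icc_subset_Icc_right ht₁.2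
  have hc : ∀ w : ℝ → L1 d, ContinuousOn w (Icc (-T) T) → (∀ t ∈ Icc (-T) T, ‖w t‖ ≤ r) →
      IntervalIntegrable (fun s => phase q (t₁ - s) (N (w s))) volume (-T) t₁ := fun w hw hwr =>
    ((continuousOn_phase_comp (q := q) hN hw hwr
      (by fun_prop : Continuous fun s : ℝ => t₁ - s)).mono hsub).intervalIntegrable
  have h1 : y t₁ - z t₁ = -(Complex.I • ∫ s in (-T)..t₁,
      (phase q (t₁ - s) (N (y s)) - phase q (t₁ - s) (N (z s)))) := by
    rw [intervalIntegral.integral_sub (hc y hy hyr) (hc z hz hzr), hyD t₁ ht₁, hzD t₁ ht₁, smul_sub]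
    abel
  have h2 : ‖y t₁ - z t₁‖ ≤ ℓ * ‖y t₁ - z t₁‖ * |t₁ - -T| := by
    nth_rewrite 1 [h1]
    rw [norm_neg, norm_smul, Complex.norm_I, one_mul]
    refine intervalIntegral.norm_integral_le_of_norm_le_const fun s hs => ?_
    have hsI := hsub (uIoc_subset_uIcc hs)
    rw [← map_sub, LinearIsometry.norm_map]
    exact (hN _ _ (hyr s hsI) (hzr s hsI)).trans (mul_le_mul_of_nonneg_left (hmax' s hsI) hℓ)
  have h3 : |t₁ - -T| ≤ 2 * T := by
    rw [abs_of_nonneg (by linarith [ht₁.1])]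
    linarith [ht₁.2]
  have h4 : ‖y t₁ - z t₁‖ ≤ 1 / 4 * ‖y t₁ - z t₁‖ := by
    refine h2.trans ?_
    calc _ ≤ ℓ * ‖y t₁ - z t₁‖ * (2 * T) := mul_le_mul_of_nonneg_left h3 (by positivity)
      _ = 2 * T * ℓ * ‖y t₁ - z t₁‖ := by ring
      _ ≤ _ := mul_le_mul_of_nonneg_right hsmall (norm_nonneg _)
  have h5 : ‖y t₁ - z t₁‖ ≤ 0 := by linarith
  intro t ht
  rw [← sub_eq_zero, ← norm_le_zero_iff]
  exact (hmax' t ht).trans h5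

end Mild

/-! ### Well-posedness in `FL¹` -/

/-- Small data well-posedness: existence, uniqueness and a bound for the Duhamel term. -/
theorem exists_unique_solution {n : ℕ} {G : ℝ≥0 → ℝ≥0} {β : E d → ℝ} {T : ℝ} {u₀ : E d → ℂ}
    {f₀ : L1 d} (hu₀ : ∀ x, u₀ x = evalCLM x f₀) {N : L1 d → L1 d} {r ℓ : ℝ}
    (hT : 0 < T) (hr : 0 < r) (hℓ : 0 ≤ ℓ)
    (hN : ∀ f g, ‖f‖ ≤ r → ‖g‖ ≤ r → ‖N f - N g‖ ≤ ℓ * ‖f - g‖) (hN0 : N 0 = 0)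
    (hf₀ : ‖f₀‖ ≤ r / 2) (hsmall : 2 * T * ℓ ≤ 1 / 4)
    (hNG : ∀ f : L1 d, ‖f‖ ≤ r → ∀ x,
      nonlinearity G β (fun x => evalCLM x f) x = evalCLM x (N f)) :
    ∃ y : ℝ → L1 d, IsSolution n G β T u₀ (fun t x => evalCLM x (y t)) ∧
      (∀ w, IsSolution n G β T u₀ w → ∀ t ∈ Icc (-T) T, w t = fun x => evalCLM x (y t)) ∧
      ∀ t ∈ Icc (-T) T, ‖y t - propagator n (t + T) f₀‖ ≤ 2 * T * ℓ * r := by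
  obtain ⟨y, hyc, hyr, hy0, hyD⟩ := exists_mild (q := dispersion d n) hT hr hℓ hN hN0 hf₀ hsmall
  have hfu₀ : fourierFL1 u₀ = f₀ := fourierFL1_eq hu₀
  have hfy : ∀ t, fourierFL1 (fun x => evalCLM x (y t)) = y t := fun t => fourierFL1_eq fun _ => rfl
  have hfN : ∀ t ∈ Icc (-T) T,
      fourierFL1 (nonlinearity G β (fun x => evalCLM x (y t))) = N (y t) := fun t ht =>
    fourierFL1_eq (hNG (y t) (hyr t ht))
  refine ⟨y, ?_, fun w hw => ?_, fun t ht => ?_⟩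
  · refine ⟨fun t _ => memFL1_eval _, ?_, fun t ht => ⟨_, hNG (y t) (hyr t ht)⟩, ?_, ?_, ?_⟩
    · simpa only [hfy] using hyc
    · have h1 : ContinuousOn (fun t => N (y t)) (Icc (-T) T) :=
        (continuousOn_of_ball_lipschitz hN).comp hyc
          (fun t ht => mem_closedBall_zero_iff.2 (hyr t ht) :
            MapsTo y (Icc (-T) T) (Metric.closedBall 0 r))
      rw [← uIcc_of_le (by linarith : -T ≤ T)] at h1 hfN
      refine ContinuousOn.intervalIntegrable (h1.congr hfN)
    · funext x
      rw [hu₀, hy0]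
    · intro t ht
      rw [hfy, hfu₀, hyD t ht, propagator_eq_phase]
      congr 2
      refine intervalIntegral.integral_congr fun s hs => ?_
      rw [uIcc_of_le ht.1] at hs
      simp only [propagator_eq_phase]
      rw [hfN s ⟨hs.1, hs.2.trans ht.2⟩]
  · have hwe : ∀ t ∈ Icc (-T) T, (fun x => evalCLM x (fourierFL1 (w t))) = w t := fun t ht =>
      funext fun x => evalCLM_fourierFL1 (hw.mem t ht) x
    have hwN : ∀ t ∈ Icc (-T) T, ‖fourierFL1 (w t)‖ ≤ r →
        fourierFL1 (nonlinearity G β (w t)) = N (fourierFL1 (w t)) := fun t ht htr =>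
      fourierFL1_eq fun x => by rw [← hNG _ htr, hwe t ht]
    have hwD : ∀ t ∈ Icc (-T) T, fourierFL1 (w t) = phase (dispersion d n) (t + T) f₀ -
        Complex.I • ∫ s in (-T)..t,
          phase (dispersion d n) (t - s) (fourierFL1 (nonlinearity G β (w s))) := fun t ht => by
      rw [hw.duhamel t ht, hfu₀]
      simp only [propagator_eq_phase]
    -- An arbitrary solution is not known to be small, and its nonlinearity is given by `N` only
    -- inside the ball; the exit argument supplies this.
    have hwr := mild_norm_lt hr hℓ hN hN0 hf₀ hsmall hw.continuousOn hwN hwD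
    have hwD' : ∀ t ∈ Icc (-T) T, fourierFL1 (w t) = phase (dispersion d n) (t + T) f₀ -
        Complex.I • ∫ s in (-T)..t,
          phase (dispersion d n) (t - s) (N (fourierFL1 (w s))) := fun t ht => by
      rw [hwD t ht]
      congr 2
      refine intervalIntegral.integral_congr fun s hs => ?_
      rw [uIcc_of_le ht.1] at hs
      have hsI : s ∈ Icc (-T) T := ⟨hs.1, hs.2.trans ht.2⟩
      rw [hwN s hsI (hwr s hsI).le]
    have huniq := mild_unique hT hℓ hN hsmall hw.continuousOn (fun t ht => (hwr t ht).le) hwD'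
      hyc hyr hyD
    intro t ht
    rw [← hwe t ht, huniq t ht]
  · rw [hyD t ht, propagator_eq_phase, sub_sub_cancel_left, norm_neg, norm_smul, Complex.norm_I,
      one_mul]
    have h1 : ‖∫ s in (-T)..t, phase (dispersion d n) (t - s) (N (y s))‖ ≤ ℓ * r * |t - -T| := by
      refine intervalIntegral.norm_integral_le_of_norm_le_const fun s hs => ?_
      rw [uIoc_of_le ht.1] at hs
      rw [LinearIsometry.norm_map]
      exact norm_le_of_ball_lipschitz hN hN0 hℓ (hyr s ⟨hs.1.le, hs.2.trans ht.2⟩)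
    have h2 : |t - -T| ≤ 2 * T := by
      rw [abs_of_nonneg (by linarith [ht.1])]
      linarith [ht.2]
    refine h1.trans ((mul_le_mul_of_nonneg_left h2 (by positivity)).trans (le_of_eq (by ring)))

/-! ### Fourier transforms of Schwartz functions -/

/-- The Fourier transform of a Schwartz function, in the unitary convention. -/
def schwartzHat (φ : SchwartzMap (E d) ℂ) (y : E d) : ℂ :=
  fourierConst d * 𝓕 φ ((2 * Real.pi)⁻¹ • y)

theorem fourierConst_sq_mul (d : ℕ) : fourierConst d * fourierConst d * (2 * Real.pi) ^ d = 1 := by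
  rw [fourierConst, ← Real.rpow_add (by positivity), ← Real.rpow_natCast,
    ← Real.rpow_add (by positivity)]
  ring_nf
  exact Real.rpow_zero _

theorem invFourier_schwartzHat (φ : SchwartzMap (E d) ℂ) (x : E d) :
    invFourier (schwartzHat φ) x = φ x := by
  have h1 : φ x = ∫ z : E d, Complex.exp ((2 * Real.pi * inner ℝ z x : ℝ) * Complex.I) * 𝓕 φ z := by
    have h2 : 𝓕⁻ (𝓕 φ) x = φ x := by rw [FourierTransform.fourierInv_fourier_eq]
    rw [← h2, SchwartzMap.fourierInv_coe, Real.fourierInv_eq']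
    rfl
  have h3 := Measure.integral_comp_inv_smul_of_nonneg (volume : Measure (E d))
    (fun z : E d => Complex.exp ((2 * Real.pi * inner ℝ z x : ℝ) * Complex.I) * 𝓕 φ z)
    (R := 2 * Real.pi) (by positivity)
  rw [← h1, finrank_euclideanSpace_fin] at h3
  have h4 : ∀ y : E d, Complex.exp (Complex.I * ((inner ℝ x y : ℝ) : ℂ)) * schwartzHat φ y =
      (fourierConst d : ℂ) * (Complex.exp ((2 * Real.pi * inner ℝ ((2 * Real.pi)⁻¹ • y) x : ℝ) *
        Complex.I) * 𝓕 φ ((2 * Real.pi)⁻¹ • y)) := fun y => by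
    rw [schwartzHat, real_inner_smul_left, mul_inv_cancel_left₀ (by positivity), real_inner_comm,
      mul_comm Complex.I]
    ring
  rw [invFourier]
  simp only [h4]
  rw [integral_const_mul, h3, Complex.real_smul, ← mul_assoc, ← mul_assoc]
  have h5 := fourierConst_sq_mul d
  rw [fourierConst] at h5 ⊢
  rw [← Complex.ofReal_mul, ← Complex.ofReal_mul, h5, Complex.ofReal_one, one_mul]

theorem continuous_schwartzHat (φ : SchwartzMap (E d) ℂ) : Continuous (schwartzHat φ) := by
  unfold schwartzHat
  fun_prop

theorem integrable_pow_mul_schwartzHat (φ : SchwartzMap (E d) ℂ) (k : ℕ) :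
    Integrable (fun y => ‖y‖ ^ k * ‖schwartzHat φ y‖) := by
  have h1 := ((𝓕 φ).integrable_pow_mul volume k).comp_smul (R := (2 * Real.pi)⁻¹) (by positivity)
  refine (h1.const_mul (fourierConst d * (2 * Real.pi) ^ k)).congr (Eventually.of_forall fun y => ?_)
  simp only [schwartzHat, norm_mul, norm_smul, mul_pow, Complex.norm_real, norm_inv, inv_pow]
  rw [Real.norm_of_nonneg (fourierConst_pos d).le, Real.norm_of_nonneg Real.pi_pos.le,
    Real.norm_two]
  field_simp

theorem integrable_schwartzHat (φ : SchwartzMap (E d) ℂ) : Integrable (schwartzHat φ) := by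
  refine (integrable_norm_iff (continuous_schwartzHat φ).aestronglyMeasurable).1 ?_
  simpa using integrable_pow_mul_schwartzHat φ 0

theorem integrable_one_add_pow_mul_schwartzHat (φ : SchwartzMap (E d) ℂ) (k : ℕ) :
    Integrable (fun y => (1 + ‖y‖) ^ k * ‖schwartzHat φ y‖) := by
  have h1 : Integrable (fun y => 2 ^ (k - 1) *
      (‖schwartzHat φ y‖ + ‖y‖ ^ k * ‖schwartzHat φ y‖)) :=
    ((integrable_schwartzHat φ).norm.add (integrable_pow_mul_schwartzHat φ k)).const_mul _
  have hc := continuous_schwartzHat φ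
  refine h1.mono' (by fun_prop) (Eventually.of_forall fun y => ?_)
  rw [Real.norm_of_nonneg (by positivity)]
  have h2 := add_pow_le (zero_le_one' ℝ) (norm_nonneg y) k
  rw [one_pow] at h2
  calc _ ≤ (2 ^ (k - 1) * (1 + ‖y‖ ^ k)) * ‖schwartzHat φ y‖ :=
        mul_le_mul_of_nonneg_right h2 (norm_nonneg _)
    _ = _ := by ring

/-! ### Rescaling and translation of the frequency -/

theorem integral_rescale {F : Type*} [NormedAddCommGroup F] [NormedSpace ℝ F] (g : E d → F)
    {ε : ℝ} (hε : 0 < ε) (ξ : E d) :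
    ∫ y, (ε ^ d)⁻¹ • g (ε⁻¹ • (y - ξ)) = ∫ z, g z := by
  rw [integral_sub_right_eq_self (fun y => (ε ^ d)⁻¹ • g (ε⁻¹ • y)) ξ, integral_smul,
    Measure.integral_comp_inv_smul_of_nonneg volume g hε.le, finrank_euclideanSpace_fin,
    inv_smul_smul₀ (by positivity)]

/-- The Fourier transform of `x ↦ e^{i x·ξ} w(ε x)` when `g` is that of `w`. -/
def rescale (ε : ℝ) (ξ : E d) (g : E d → ℂ) (y : E d) : ℂ := (ε ^ d)⁻¹ • g (ε⁻¹ • (y - ξ))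

theorem integrable_rescale {g : E d → ℂ} (hg : Integrable g) {ε : ℝ} (hε : 0 < ε) (ξ : E d) :
    Integrable (rescale ε ξ g) :=
  ((hg.comp_smul (inv_ne_zero hε.ne')).comp_sub_right ξ).smul ((ε ^ d)⁻¹)

theorem invFourier_rescale (g : E d → ℂ) {ε : ℝ} (hε : 0 < ε) (ξ x : E d) :
    invFourier (rescale ε ξ g) x =
      Complex.exp (Complex.I * ((inner ℝ x ξ : ℝ) : ℂ)) * invFourier g (ε • x) := by
  rw [invFourier, invFourier, mul_left_comm,
    ← integral_const_mul (Complex.exp (Complex.I * ((inner ℝ x ξ : ℝ) : ℂ))),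
    ← integral_rescale (fun y => Complex.exp (Complex.I * ((inner ℝ x ξ : ℝ) : ℂ)) *
      (Complex.exp (Complex.I * ((inner ℝ (ε • x) y : ℝ) : ℂ)) * g y)) hε ξ]
  congr 2
  funext y
  rw [rescale, mul_smul_comm]
  congr 1
  rw [← mul_assoc, ← Complex.exp_add, ← mul_add, ← Complex.ofReal_add, inner_smul_left,
    inner_smul_right, RCLike.conj_to_real, mul_inv_cancel_left₀ hε.ne', ← inner_add_right,
    add_sub_cancel]

theorem integral_mul_norm_rescale (g : E d → ℂ) {ε : ℝ} (hε : 0 < ε) (ξ : E d) (W : E d → ℝ) :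
    ∫ y, W y * ‖rescale ε ξ g y‖ = ∫ z, W (ξ + ε • z) * ‖g z‖ := by
  rw [← integral_rescale (fun z => W (ξ + ε • z) * ‖g z‖) hε ξ]
  congr 1
  funext y
  rw [smul_inv_smul₀ hε.ne', add_sub_cancel, rescale, norm_smul, norm_inv, norm_pow,
    Real.norm_of_nonneg hε.le, smul_eq_mul]
  ring

/-! ### The dispersion relation near frequency `ξ` -/

/-- The Taylor remainder satisfies `R_{n+1} = (1 + x) R_n + n x²`, and `n² + n ≤ (n + 1)²`. The
polynomial growth is harmless because it is integrated against Schwartz functions. -/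
theorem abs_one_add_pow_sub_le (n : ℕ) (x : ℝ) :
    |(1 + x) ^ n - 1 - n * x| ≤ n ^ 2 * x ^ 2 * (1 + |x|) ^ n := by
  induction n with
  | zero => simp
  | succ n ih =>
    have h1 : (1 + x) ^ (n + 1) - 1 - ((n + 1 : ℕ) : ℝ) * x =
        (1 + x) * ((1 + x) ^ n - 1 - n * x) + n * x ^ 2 := by
      push_cast
      ring
    have h2 : |1 + x| ≤ 1 + |x| := (abs_add_le 1 x).trans (by rw [abs_one])
    have h3 : (1 : ℝ) ≤ (1 + |x|) ^ (n + 1) := one_le_pow₀ (by linarith [abs_nonneg x])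
    rw [h1]
    calc _ ≤ |1 + x| * |(1 + x) ^ n - 1 - n * x| + n * x ^ 2 := by
          refine (abs_add_le _ _).trans ?_
          rw [abs_mul, abs_of_nonneg (by positivity : (0 : ℝ) ≤ n * x ^ 2)]
      _ ≤ (1 + |x|) * (n ^ 2 * x ^ 2 * (1 + |x|) ^ n) + n * x ^ 2 * (1 + |x|) ^ (n + 1) := by
          refine add_le_add (by gcongr) (le_mul_of_one_le_right (by positivity) h3)
      _ = (n ^ 2 + n) * (x ^ 2 * (1 + |x|) ^ (n + 1)) := by ring
      _ ≤ ((n + 1 : ℕ) : ℝ) ^ 2 * (x ^ 2 * (1 + |x|) ^ (n + 1)) := by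
          refine mul_le_mul_of_nonneg_right ?_ (by positivity)
          push_cast
          nlinarith [(Nat.cast_nonneg n : (0 : ℝ) ≤ n)]
      _ = _ := by ring

/-- Second-order Taylor estimate of `|y|^{2n}/2n` at a unit vector. -/
theorem abs_affineSymbol_sub_dispersion_le {n : ℕ} (hn : 1 ≤ n) {ξ : E d} (hξ : ‖ξ‖ = 1)
    (ζ : E d) :
    |affineSymbol (1 / (2 * n) - 1) ξ (ξ + ζ) - dispersion d n (ξ + ζ)| ≤
      (2 * n + 1) * (‖ζ‖ ^ 2 * (1 + ‖ζ‖) ^ (2 * n + 2)) := by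
  have hn0 : (1 : ℝ) ≤ n := by exact_mod_cast hn
  set x : ℝ := 2 * inner ℝ ξ ζ + ‖ζ‖ ^ 2 with hx
  have h1 : ‖ξ + ζ‖ ^ (2 * n) = (1 + x) ^ n := by
    rw [pow_mul, norm_add_sq_real, hξ, hx]
    ring_nf
  -- The dispersion has value `1/(2n)` and gradient `ξ` at `ξ`; since `ξ · ξ = 1`, its tangent has
  -- constant term `1/(2n) - 1`.
  have h2 : affineSymbol (1 / (2 * n) - 1) ξ (ξ + ζ) - dispersion d n (ξ + ζ) =
      -(((1 + x) ^ n - 1 - n * x) / (2 * n) + ‖ζ‖ ^ 2 / 2) := by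
    rw [affineSymbol, dispersion, ContinuousMap.coe_mk, ContinuousMap.coe_mk, h1, inner_add_right,
      real_inner_self_eq_norm_sq, hξ]
    field_simp
    rw [hx]
    ring
  set z := ‖ζ‖ with hz
  have hz0 : 0 ≤ z := norm_nonneg ζ
  have hin : |inner ℝ ξ ζ| ≤ z := by simpa [hξ] using abs_real_inner_le_norm ξ ζ
  have h3 : |x| ≤ 2 * z + z ^ 2 := by
    refine (abs_add_le _ _).trans ?_
    rw [abs_mul, abs_two, abs_of_nonneg (sq_nonneg z)]
    linarith
  have h4 : x ^ 2 ≤ 4 * (z ^ 2 * (1 + z) ^ 2) := by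
    rw [← sq_abs]
    have : |x| ^ 2 ≤ (2 * z + z ^ 2) ^ 2 := pow_le_pow_left₀ (abs_nonneg x) h3 2
    nlinarith [mul_nonneg hz0 hz0, mul_nonneg (mul_nonneg hz0 hz0) hz0]
  have h5 : (1 + |x|) ^ n ≤ (1 + z) ^ (2 * n) := by
    rw [pow_mul]
    exact pow_le_pow_left₀ (by positivity) (by nlinarith) n
  have h6 : |(1 + x) ^ n - 1 - n * x| ≤ n ^ 2 * (4 * (z ^ 2 * (1 + z) ^ 2)) * (1 + z) ^ (2 * n) :=
    (abs_one_add_pow_sub_le n x).trans (by gcongr)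
  have h7 : (1 : ℝ) ≤ (1 + z) ^ (2 * n + 2) := one_le_pow₀ (by linarith)
  rw [h2, abs_neg]
  calc _ ≤ |(1 + x) ^ n - 1 - n * x| / (2 * n) + z ^ 2 / 2 := by
        refine (abs_add_le _ _).trans ?_
        rw [abs_div, abs_of_nonneg (by positivity : (0 : ℝ) ≤ 2 * n),
          abs_of_nonneg (by positivity : 0 ≤ z ^ 2 / 2)]
    _ ≤ (n ^ 2 * (4 * (z ^ 2 * (1 + z) ^ 2)) * (1 + z) ^ (2 * n)) / (2 * n) +
          z ^ 2 * (1 + z) ^ (2 * n + 2) := by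
        gcongr
        have := le_mul_of_one_le_right (sq_nonneg z) h7
        linarith [sq_nonneg z]
    _ = _ := by
        rw [pow_add]
        field_simp
        ring

theorem norm_exp_I_mul_sub_le (a b : ℝ) :
    ‖Complex.exp (Complex.I * (a : ℂ)) - Complex.exp (Complex.I * (b : ℂ))‖ ≤ |a - b| := by
  have h1 : Complex.exp (Complex.I * (a : ℂ)) - Complex.exp (Complex.I * (b : ℂ)) =
      Complex.exp (Complex.I * (b : ℂ)) * (Complex.exp (Complex.I * ((a - b : ℝ) : ℂ)) - 1) := by
    rw [mul_sub, ← Complex.exp_add, mul_one]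
    congr 2
    push_cast
    ring
  rw [h1, norm_mul, norm_exp_I_mul, one_mul]
  exact Real.norm_exp_I_mul_ofReal_sub_one_le

/-- The free evolution of a rescaled profile is a transport up to `O(ε²)`. -/
theorem norm_phase_affine_sub_phase_dispersion_le {n : ℕ} (hn : 1 ≤ n) {ξ : E d} (hξ : ‖ξ‖ = 1)
    (φ : SchwartzMap (E d) ℂ) {ε : ℝ} (hε : 0 < ε) (hε1 : ε ≤ 1) (s : ℝ) :
    ‖phase (affineSymbol (1 / (2 * n) - 1) ξ) s
        ((integrable_rescale (integrable_schwartzHat φ) hε ξ).toL1 _) -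
      phase (dispersion d n) s ((integrable_rescale (integrable_schwartzHat φ) hε ξ).toL1 _)‖ ≤
      |s| * (2 * n + 1) * (∫ z, (1 + ‖z‖) ^ (2 * n + 4) * ‖schwartzHat φ z‖) * ε ^ 2 := by
  rw [norm_phase_sub_phase]
  have h1 : ∫ y, ‖Complex.exp (Complex.I * ((s * affineSymbol (1 / (2 * n) - 1) ξ y : ℝ) : ℂ)) -
        Complex.exp (Complex.I * ((s * dispersion d n y : ℝ) : ℂ))‖ *
        ‖((integrable_rescale (integrable_schwartzHat φ) hε ξ).toL1 _ : L1 d) y‖ =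
      ∫ y, ‖Complex.exp (Complex.I * ((s * affineSymbol (1 / (2 * n) - 1) ξ y : ℝ) : ℂ)) -
        Complex.exp (Complex.I * ((s * dispersion d n y : ℝ) : ℂ))‖ *
        ‖rescale ε ξ (schwartzHat φ) y‖ := by
    refine integral_congr_ae ?_
    filter_upwards [(integrable_rescale (integrable_schwartzHat φ) hε ξ).coeFn_toL1] with y hy
    rw [hy]
  -- In the variable `y = ξ + ε z` the quadratic remainder of the symbol yields the factor `ε²`.
  rw [h1, integral_mul_norm_rescale (schwartzHat φ) hε ξ, mul_assoc, mul_assoc,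
    mul_comm _ (ε ^ 2), ← mul_assoc, ← mul_assoc, ← integral_const_mul]
  refine integral_mono_of_nonneg (Eventually.of_forall fun z => by positivity)
    ((integrable_one_add_pow_mul_schwartzHat φ (2 * n + 4)).const_mul _)
    (Eventually.of_forall fun z => ?_)
  simp only
  rw [← mul_assoc]
  refine mul_le_mul_of_nonneg_right ((norm_exp_I_mul_sub_le _ _).trans ?_) (norm_nonneg _)
  rw [← mul_sub, abs_mul, mul_assoc, mul_assoc]
  refine mul_le_mul_of_nonneg_left ?_ (abs_nonneg s)
  refine (abs_affineSymbol_sub_dispersion_le hn hξ (ε • z)).trans ?_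
  refine mul_le_mul_of_nonneg_left ?_ (by positivity)
  rw [norm_smul, Real.norm_of_nonneg hε.le]
  have hz : ε * ‖z‖ ≤ ‖z‖ := mul_le_of_le_one_left (norm_nonneg z) hε1
  have hz' : ‖z‖ ^ 2 ≤ (1 + ‖z‖) ^ 2 := pow_le_pow_left₀ (norm_nonneg z) (by linarith) 2
  calc (ε * ‖z‖) ^ 2 * (1 + ε * ‖z‖) ^ (2 * n + 2)
      ≤ (ε ^ 2 * (1 + ‖z‖) ^ 2) * (1 + ‖z‖) ^ (2 * n + 2) := by
        rw [mul_pow]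
        gcongr
    _ = _ := by ring

/-- The rescaling is `L¹`-invariant, so the smallness of the packet comes from `ε^p` alone. -/
theorem norm_toL1_rescale (g : E d → ℂ) (hg : Integrable g) {ε : ℝ} (hε : 0 < ε) (ξ : E d) :
    ‖(integrable_rescale hg hε ξ).toL1 _‖ = ∫ z, ‖g z‖ := by
  rw [L1.norm_of_fun_eq_integral_norm]
  simpa using integral_mul_norm_rescale g hε ξ fun _ => 1

/-! ### The wave packet -/

theorem wavePacket_eq (n : ℕ) (p : ℝ) (G : ℝ≥0 → ℝ≥0) (a₀ : E d → ℂ) (β : E d → ℝ) (T : ℝ)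
    (ξ : E d) {ε : ℝ} (hε : 0 < ε) (t : ℝ) (x : E d) :
    wavePacket n p G a₀ β T ξ ε t x =
      ((ε ^ p : ℝ) : ℂ) * (a₀ (ε • (x + (t + 2 * T) • ξ)) * Complex.exp (-Complex.I *
        (((G (Real.toNNReal (ε ^ (2 * p) * ‖a₀ (ε • (x + (t + 2 * T) • ξ))‖ ^ 2)) : ℝ) *
          ∫ r in (0 : ℝ)..(t + T), β (x + r • ξ) : ℝ) : ℂ))) *
        Complex.exp (Complex.I * ((inner ℝ x ξ + t / (2 * n) : ℝ) : ℂ)) := by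
  have hc : ε ^ (-(2 * (n : ℤ))) * ε ^ (2 * n) = 1 := by
    rw [← zpow_natCast ε (2 * n), ← zpow_add₀ hε.ne']
    push_cast
    rw [neg_add_cancel, zpow_zero]
  have hc0 : ε ^ (-(2 * (n : ℤ))) ≠ 0 := zpow_ne_zero _ hε.ne'
  have h1 : ε • (x + T • ξ) + (ε ^ (1 - 2 * (n : ℤ)) * (ε ^ (2 * n) * (t + T))) • ξ =
      ε • (x + (t + 2 * T) • ξ) := by
    rw [sub_eq_add_neg, zpow_add₀ hε.ne', zpow_one, ← mul_assoc, mul_assoc ε, hc]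
    module
  -- Substitute `r = t + T - ε^{-2n} s`; the prefactor `ε^{-2n}` is exactly the Jacobian.
  have h2 : ε ^ (-(2 * (n : ℤ))) * ∫ s in (0 : ℝ)..(ε ^ (2 * n) * (t + T)),
      β (ε⁻¹ • (ε • (x + T • ξ)) + (ε ^ (-(2 * (n : ℤ))) * (ε ^ (2 * n) * (t + T) - s)) • ξ - T • ξ)
      = ∫ r in (0 : ℝ)..(t + T), β (x + r • ξ) := by
    have h3 : ∀ s, ε⁻¹ • (ε • (x + T • ξ)) +
        (ε ^ (-(2 * (n : ℤ))) * (ε ^ (2 * n) * (t + T) - s)) • ξ - T • ξ =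
        x + ((t + T) - ε ^ (-(2 * (n : ℤ))) * s) • ξ := fun s => by
      rw [inv_smul_smul₀ hε.ne', mul_sub, ← mul_assoc, hc]
      module
    simp only [h3]
    rw [intervalIntegral.integral_comp_sub_mul (fun r => β (x + r • ξ)) hc0, smul_eq_mul,
      mul_inv_cancel_left₀ hc0, ← mul_assoc, hc]
    simp
  simp only [wavePacket, amplitude]
  rw [h1, mul_right_comm (ε ^ (-(2 * (n : ℤ)))), h2, mul_comm (∫ r in (0 : ℝ)..(t + T), _)]

theorem integral_eq_xray {β : E d → ℝ} {T : ℝ} (hβT : tsupport β ⊆ {x | ‖x‖ < T})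
    {ξ : E d} (hξ : ‖ξ‖ = 1) {y : E d} (hy : inner ℝ y ξ = 0) :
    ∫ r in (0 : ℝ)..(T + T), β (y - T • ξ + r • ξ) = xray β y ξ := by
  have h1 : ∀ r : ℝ, y - T • ξ + r • ξ = y + (r - T) • ξ := fun r => by module
  simp only [h1]
  rw [intervalIntegral.integral_comp_sub_right (fun r => β (y + r • ξ)), zero_sub,
    add_sub_cancel_right, xray]
  refine intervalIntegral.integral_eq_integral_of_support_subset fun τ hτ => ?_
  have h2 : ‖y + τ • ξ‖ < T := hβT (subset_tsupport β hτ)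
  -- By Pythagoras, a point of the line inside the ball of radius `T` has `|τ| < T`, so the segment
  -- misses nothing.
  have h3 : ‖y + τ • ξ‖ ^ 2 = ‖y‖ ^ 2 + τ ^ 2 := by
    rw [norm_add_sq_real, inner_smul_right, hy, norm_smul, hξ, Real.norm_eq_abs, mul_one, sq_abs]
    ring
  have h4 : |τ| < T := by
    refine lt_of_le_of_lt ?_ h2
    refine abs_le_of_sq_le_sq ?_ (norm_nonneg _)
    nlinarith [sq_nonneg ‖y‖]
  exact ⟨(abs_lt.1 h4).1, (abs_lt.1 h4).2.le⟩

/-- The Fourier transform of the wave packet without nonlinear phase,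
`ε^p a₀(ε (x + (t + 2T) ξ)) e^{i (x·ξ + t/(2n))}`. -/
def linearPacket (n : ℕ) (p : ℝ) (a₀ : SchwartzMap (E d) ℂ) (T : ℝ) (ξ : E d) {ε : ℝ}
    (hε : 0 < ε) (t : ℝ) : L1 d :=
  phase (affineSymbol (1 / (2 * n) - 1) ξ) (t + T) (((ε ^ p : ℝ) : ℂ) •
    phase (affineSymbol (-(1 / (2 * n)) - 1) ξ) T
      ((integrable_rescale (integrable_schwartzHat a₀) hε ξ).toL1 _))

theorem evalCLM_linearPacket (n : ℕ) (p : ℝ) (a₀ : SchwartzMap (E d) ℂ) (T : ℝ) {ξ : E d}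
    (hξ : ‖ξ‖ = 1) {ε : ℝ} (hε : 0 < ε) (t : ℝ) (x : E d) :
    evalCLM x (linearPacket n p a₀ T ξ hε t) =
      ((ε ^ p : ℝ) : ℂ) * a₀ (ε • (x + (t + 2 * T) • ξ)) *
        Complex.exp (Complex.I * ((inner ℝ x ξ + t / (2 * n) : ℝ) : ℂ)) := by
  have h1 : x + (t + T) • ξ + T • ξ = x + (t + 2 * T) • ξ := by module
  rw [linearPacket, evalCLM_phase_affineSymbol, map_smul, evalCLM_phase_affineSymbol,
    evalCLM_toL1, invFourier_rescale _ hε, invFourier_schwartzHat, h1, smul_eq_mul,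
    inner_add_left, real_inner_smul_left, real_inner_self_eq_norm_sq, hξ]
  -- Translating `e^{ix·ξ}` by `(t + 2T)ξ` adds `t + 2T` to the phase; the constants in the two
  -- affine symbols reduce the total to `t/(2n)`.
  have h2 : Complex.exp (Complex.I * ((inner ℝ x ξ + t / (2 * n) : ℝ) : ℂ)) =
      Complex.exp (Complex.I * (((t + T) * (1 / (2 * n) - 1) : ℝ) : ℂ)) *
      (Complex.exp (Complex.I * ((T * (-(1 / (2 * n)) - 1) : ℝ) : ℂ)) *
      Complex.exp (Complex.I * ((inner ℝ x ξ + (t + 2 * T) * 1 ^ 2 : ℝ) : ℂ))) := by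
    rw [← Complex.exp_add, ← Complex.exp_add, ← mul_add, ← mul_add, ← Complex.ofReal_add,
      ← Complex.ofReal_add]
    congr 3
    ring
  rw [h2]
  ring

theorem norm_linearPacket (n : ℕ) (p : ℝ) (a₀ : SchwartzMap (E d) ℂ) (T : ℝ) (ξ : E d) {ε : ℝ}
    (hε : 0 < ε) (t : ℝ) :
    ‖linearPacket n p a₀ T ξ hε t‖ = ε ^ p * ∫ z, ‖schwartzHat a₀ z‖ := by
  rw [linearPacket, LinearIsometry.norm_map, norm_smul, LinearIsometry.norm_map,
    norm_toL1_rescale _ (integrable_schwartzHat a₀) hε, Complex.norm_real, Real.norm_of_nonneg (by positivity)]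

/-- Transport and free evolution start from the same data at time `-T`. Fourier multipliers commute,
so the fixed phase at time `T` is an isometry that drops out of the norm. -/
theorem norm_propagator_sub_linearPacket_le {n : ℕ} (hn : 1 ≤ n) (p : ℝ)
    (a₀ : SchwartzMap (E d) ℂ) (T : ℝ) {ξ : E d} (hξ : ‖ξ‖ = 1) {ε : ℝ} (hε : 0 < ε)
    (hε1 : ε ≤ 1) (t : ℝ) :
    ‖linearPacket n p a₀ T ξ hε t - propagator n (t + T) (linearPacket n p a₀ T ξ hε (-T))‖ ≤
      |t + T| * (2 * n + 1) * (∫ z, (1 + ‖z‖) ^ (2 * n + 4) * ‖schwartzHat a₀ z‖) *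
        ε ^ (p + 2) := by
  rw [propagator_eq_phase, linearPacket, linearPacket, neg_add_cancel, phase_zero, map_smul,
    map_smul, phase_comm _ _ _ T, phase_comm (dispersion d n) _ _ T, ← smul_sub, ← map_sub,
    norm_smul, LinearIsometry.norm_map, Complex.norm_real, Real.norm_of_nonneg (by positivity),
    Real.rpow_add hε, Real.rpow_two]
  refine (mul_le_mul_of_nonneg_left (norm_phase_affine_sub_phase_dispersion_le hn hξ a₀ hε hε1
    (t + T)) (by positivity)).trans (le_of_eq (by ring))

/-- The Fourier transform of `x ↦ ∫₀^τ β(x + r ξ) dr`, where `β = 𝓕⁻¹ g`. -/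
def lineIntegralHat (ξ : E d) (g : L1 d) (τ : ℝ) : L1 d :=
  ∫ r in (0 : ℝ)..τ, phase (affineSymbol 0 ξ) r g

theorem evalCLM_lineIntegralHat {β : E d → ℝ} {g : L1 d} (hg : ∀ x, (β x : ℂ) = evalCLM x g)
    (ξ : E d) (τ : ℝ) (x : E d) :
    evalCLM x (lineIntegralHat ξ g τ) = ((∫ r in (0 : ℝ)..τ, β (x + r • ξ) : ℝ) : ℂ) := by
  rw [lineIntegralHat, ← (evalCLM x).intervalIntegral_comp_comm
    ((continuous_phase_apply (affineSymbol 0 ξ) g).intervalIntegrable 0 τ),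
    ← intervalIntegral.integral_ofReal]
  refine intervalIntegral.integral_congr fun r _ => ?_
  simp only [evalCLM_phase_affineSymbol, hg]
  simp

theorem norm_lineIntegralHat_le (ξ : E d) (g : L1 d) (τ : ℝ) :
    ‖lineIntegralHat ξ g τ‖ ≤ ‖g‖ * |τ| := by
  have h := intervalIntegral.norm_integral_le_of_norm_le_const (a := (0 : ℝ)) (b := τ)
    (f := fun r => phase (affineSymbol 0 ξ) r g) (C := ‖g‖)
    fun r _ => by rw [LinearIsometry.norm_map]
  rw [sub_zero] at h
  exact h

/-! ### Comparison of the solution with the wave packet -/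

section Approximation

variable {n : ℕ} {p : ℝ} {G : ℝ≥0 → ℝ≥0} {a₀ : SchwartzMap (E d) ℂ} {β : E d → ℝ} {T : ℝ}
  {ξ : E d} {ε ρ r : ℝ} {g : L1 d} {b : ℕ → ℝ}

/-- The Fourier transform of the wave packet. -/
theorem exists_wavePacket_hat (hξ : ‖ξ‖ = 1) (hε : 0 < ε) (hg : ∀ x, (β x : ℂ) = evalCLM x g)
    (hρ : 0 < ρ)
    (hG : ∀ x : ℝ≥0, (x : ℝ) < 2 * ρ → HasSum (fun k => b k * (x : ℝ) ^ (k + 1)) (G x : ℝ))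
    (hb : Summable fun k => ‖(b k : ℂ)‖ * ρ ^ k) (hrρ : r ^ 2 ≤ ρ / 2)
    (hpr : ε ^ p * ∫ z, ‖schwartzHat a₀ z‖ ≤ r)
    (hsmall : 2 * T * (3 * ‖g‖ * (∑' k, ‖(b k : ℂ)‖ * ρ ^ k) * r ^ 2) ≤ 1 / 4) {t : ℝ}
    (ht : t ∈ Icc (-T) T) :
    ∃ v : L1 d, (∀ x, wavePacket n p G a₀ β T ξ ε t x = evalCLM x v) ∧
      ‖v - linearPacket n p a₀ T ξ hε t‖ ≤
        2 * T * (3 * ‖g‖ * (∑' k, ‖(b k : ℂ)‖ * ρ ^ k) * r ^ 2) * r := by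
  set K := ∑' k, ‖(b k : ℂ)‖ * ρ ^ k with hK
  have hK0 : 0 ≤ K := tsum_nonneg fun k => by positivity
  set f := linearPacket n p a₀ T ξ hε t with hf
  have hfr : ‖f‖ ≤ r := by rw [hf, norm_linearPacket]; exact hpr
  have hr0 : 0 ≤ r := (norm_nonneg f).trans hfr
  have hfr2 : ‖f‖ ^ 2 ≤ r ^ 2 := pow_le_pow_left₀ (norm_nonneg f) hfr 2
  set Q := powSeries (fun k => (b k : ℂ)) (absSqOp f) with hQ
  set L := mulOp d (lineIntegralHat ξ g (t + T)) with hL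
  have hQn : ‖Q‖ ≤ K * r ^ 2 :=
    (norm_powSeries_le hρ.le hb ((norm_absSqOp_le f).trans (hfr2.trans hrρ))).trans
      (mul_le_mul_of_nonneg_left ((norm_absSqOp_le f).trans hfr2) hK0)
  have hLn : ‖L‖ ≤ ‖g‖ * (2 * T) := by
    refine (norm_mulOp_le _).trans ((norm_lineIntegralHat_le ξ g _).trans ?_)
    refine mul_le_mul_of_nonneg_left ?_ (norm_nonneg g)
    rw [abs_of_nonneg (by linarith [ht.1])]
    linarith [ht.2]
  have hT : 0 ≤ T := by linarith [ht.1, ht.2]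
  have hP : ‖(-Complex.I) • (Q * L)‖ ≤ K * r ^ 2 * (‖g‖ * (2 * T)) := by
    rw [norm_smul, norm_neg, Complex.norm_I, one_mul]
    exact (norm_mul_le _ _).trans (mul_le_mul hQn hLn (norm_nonneg _) (by positivity))
  have hsm : K * r ^ 2 * (‖g‖ * (2 * T)) = 2 * T * (3 * ‖g‖ * K * r ^ 2) / 3 := by ring
  -- The nonlinear phase factor is the exponential of a multiplication operator of norm at most
  -- `1/12`, hence close to the identity.
  refine ⟨NormedSpace.exp ((-Complex.I) • (Q * L)) f, fun x => ?_, ?_⟩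
  · have h1 := (((isMultiplier_powSeries_absSqOp hρ hG hb (hfr2.trans hrρ)).mul
      (isMultiplier_mulOp (lineIntegralHat ξ g (t + T)))).smul (-Complex.I)).exp f x
    rw [hQ, hL, h1]
    simp only
    rw [evalCLM_lineIntegralHat hg, wavePacket_eq _ _ _ _ _ _ _ hε, hf,
      evalCLM_linearPacket _ _ _ _ hξ]
    set A := a₀ (ε • (x + (t + 2 * T) • ξ)) with hA
    have h2 : ‖((ε ^ p : ℝ) : ℂ) * A *
        Complex.exp (Complex.I * ((inner ℝ x ξ + t / (2 * n) : ℝ) : ℂ))‖₊ ^ 2 =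
        Real.toNNReal (ε ^ (2 * p) * ‖A‖ ^ 2) := by
      apply NNReal.coe_injective
      rw [Real.coe_toNNReal _ (by positivity), NNReal.coe_pow, coe_nnnorm, norm_mul, norm_mul,
        norm_exp_I_mul, Complex.norm_real, Real.norm_of_nonneg (by positivity), mul_one, mul_pow,
        ← Real.rpow_natCast (ε ^ p) 2, ← Real.rpow_mul hε.le]
      congr 2
      push_cast
      ring
    rw [h2, Complex.ofReal_mul]
    ring
  · have h1 : NormedSpace.exp ((-Complex.I) • (Q * L)) f - f =
        (NormedSpace.exp ((-Complex.I) • (Q * L)) - 1) f := by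
      rw [sub_apply, one_apply_eq_self]
    rw [h1]
    refine (ContinuousLinearMap.le_opNorm _ _).trans ?_
    have h2 := norm_exp_sub_one_le_of_norm_le_one (hP.trans (by linarith))
    have h3 : 0 ≤ 2 * T * (3 * ‖g‖ * K * r ^ 2) := by positivity
    refine mul_le_mul (h2.trans ?_) hfr (norm_nonneg _) h3
    linarith

/-- Well-posedness with wave packet data, and approximation by the wave packet. -/
theorem exists_solution_near_wavePacket (hn : 1 ≤ n) (hξ : ‖ξ‖ = 1) (hT : 0 < T) (hε : 0 < ε)
    (hε1 : ε ≤ 1) (hg : ∀ x, (β x : ℂ) = evalCLM x g) (hρ : 0 < ρ)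
    (hG : ∀ x : ℝ≥0, (x : ℝ) < 2 * ρ → HasSum (fun k => b k * (x : ℝ) ^ (k + 1)) (G x : ℝ))
    (hb : Summable fun k => ‖(b k : ℂ)‖ * ρ ^ k) (hr : 0 < r) (hrρ : r ^ 2 ≤ ρ / 2)
    (hpr : ε ^ p * ∫ z, ‖schwartzHat a₀ z‖ ≤ r / 2)
    (hsmall : 2 * T * (3 * ‖g‖ * (∑' k, ‖(b k : ℂ)‖ * ρ ^ k) * r ^ 2) ≤ 1 / 4) :
    ∃ u : ℝ → E d → ℂ, IsSolution n G β T (wavePacket n p G a₀ β T ξ ε (-T)) u ∧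
      (∀ w, IsSolution n G β T (wavePacket n p G a₀ β T ξ ε (-T)) w →
        ∀ t ∈ Icc (-T) T, w t = u t) ∧
      normLinftyFL1 T (fun t x => u t x - wavePacket n p G a₀ β T ξ ε t x) ≤ ENNReal.ofReal
        (2 * T * (2 * n + 1) * (∫ z, (1 + ‖z‖) ^ (2 * n + 4) * ‖schwartzHat a₀ z‖) * ε ^ (p + 2) +
          12 * T * ‖g‖ * (∑' k, ‖(b k : ℂ)‖ * ρ ^ k) * r ^ 3) := by
  set K := ∑' k, ‖(b k : ℂ)‖ * ρ ^ k with hK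
  have hK0 : 0 ≤ K := tsum_nonneg fun k => by positivity
  set J := ∫ z, (1 + ‖z‖) ^ (2 * n + 4) * ‖schwartzHat a₀ z‖ with hJ
  have hJ0 : 0 ≤ J := integral_nonneg fun z => by positivity
  have hu₀ : ∀ x, wavePacket n p G a₀ β T ξ ε (-T) x =
      evalCLM x (linearPacket n p a₀ T ξ hε (-T)) := fun x => by
    rw [wavePacket_eq _ _ _ _ _ _ _ hε, evalCLM_linearPacket _ _ _ _ hξ, neg_add_cancel,
      intervalIntegral.integral_same]
    simp
  obtain ⟨y, hy, hyu, hyb⟩ := exists_unique_solution (n := n) (G := G) (β := β) hu₀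
    (N := nonlin (fun k => (b k : ℂ)) g) hT hr (ℓ := 3 * ‖g‖ * K * r ^ 2) (by positivity)
    (fun f f' hf hf' => norm_nonlin_sub_le hρ.le hb g hrρ hf hf') (nonlin_zero _ g)
    (by rw [norm_linearPacket]; exact hpr) hsmall
    (fun f hf x => nonlinearity_eval hg hρ hG hb
      ((pow_le_pow_left₀ (norm_nonneg f) hf 2).trans hrρ) x)
  refine ⟨fun t x => evalCLM x (y t), hy, hyu, iSup₂_le fun t ht => ?_⟩
  obtain ⟨v, hv, hvn⟩ := exists_wavePacket_hat (n := n) (p := p) (a₀ := a₀) hξ hε hg hρ hG hb hrρ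
    (hpr.trans (by linarith)) hsmall ht
  have h1 : ∀ x, evalCLM x (y t) - wavePacket n p G a₀ β T ξ ε t x = evalCLM x (y t - v) :=
    fun x => by rw [hv, map_sub]
  rw [normFL1_eq h1, ← ofReal_norm]
  refine ENNReal.ofReal_le_ofReal ?_
  have h2 := norm_propagator_sub_linearPacket_le hn p a₀ T hξ hε hε1 t
  rw [← hJ] at h2
  have h3 : |t + T| ≤ 2 * T := by
    rw [abs_of_nonneg (by linarith [ht.1])]
    linarith [ht.2]
  have h4 : |t + T| * (2 * n + 1) * J * ε ^ (p + 2) ≤ 2 * T * (2 * n + 1) * J * ε ^ (p + 2) :=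
    mul_le_mul_of_nonneg_right (mul_le_mul_of_nonneg_right
      (mul_le_mul_of_nonneg_right h3 (by positivity)) hJ0) (by positivity)
  -- The three errors: Duhamel term, linearised dispersion, nonlinear phase.
  have h5 : y t - v = (y t - propagator n (t + T) (linearPacket n p a₀ T ξ hε (-T))) -
      (linearPacket n p a₀ T ξ hε t -
        propagator n (t + T) (linearPacket n p a₀ T ξ hε (-T))) -
      (v - linearPacket n p a₀ T ξ hε t) := by abel
  rw [h5]
  refine (norm_sub_le _ _).trans ?_
  refine (add_le_add (norm_sub_le _ _) le_rfl).trans ?_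
  have h6 := hyb t ht
  have h7 : 2 * T * (3 * ‖g‖ * K * r ^ 2) * r + 2 * T * (3 * ‖g‖ * K * r ^ 2) * r =
      12 * T * ‖g‖ * K * r ^ 3 := by ring
  linarith

end Approximation

/-- For `ε ≤ 1` the power `ε^{3p}` is dominated by `ε^{3p-2n-σ}`, whose exponent is no larger. -/
theorem error_le_max {A B M p σ ε : ℝ} {n : ℕ} (hA : 0 ≤ A) (hB : 0 ≤ B) (hM : 0 ≤ M)
    (hε0 : 0 < ε) (hε1 : ε ≤ 1) (hσ : 0 ≤ σ) :
    A * ε ^ (p + 2) + B * (M * ε ^ p) ^ 3 ≤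
      (A + B * M ^ 3 + 1) * max (ε ^ (p + 2)) (ε ^ (3 * p - 2 * n - σ)) := by
  set X := max (ε ^ (p + 2)) (ε ^ (3 * p - 2 * n - σ)) with hX
  have h1 : ε ^ (p + 2) ≤ X := le_max_left _ _
  have h2 : (ε ^ p) ^ 3 ≤ X := by
    refine le_trans ?_ (le_max_right _ _)
    rw [← Real.rpow_natCast, ← Real.rpow_mul hε0.le]
    refine Real.rpow_le_rpow_of_exponent_ge hε0 hε1 ?_
    have : (0 : ℝ) ≤ n := Nat.cast_nonneg n
    push_cast
    linarith
  have h3 : 0 ≤ X := le_trans (by positivity) h1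
  calc A * ε ^ (p + 2) + B * (M * ε ^ p) ^ 3
      = A * ε ^ (p + 2) + B * M ^ 3 * (ε ^ p) ^ 3 := by ring
    _ ≤ A * X + B * M ^ 3 * X :=
        add_le_add (mul_le_mul_of_nonneg_left h1 hA)
          (mul_le_mul_of_nonneg_left h2 (by positivity))
    _ ≤ _ := by linarith

end HigherNLS

end

/-! ### The main theorem -/

theorem theorem1p1 (d n : ℕ) (hd : 1 ≤ d) (hn : 1 ≤ n) (p : ℝ) (hp : (n : ℝ) < p)
    (G : ℝ≥0 → ℝ≥0) (R : ℝ) (hR : 0 < R) (c : ℕ → ℝ)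
    (hG : ∀ x : ℝ≥0, (x : ℝ) < R →
      HasSum (fun k : ℕ => c (k + 1) / ((k + 1).factorial : ℝ) * (x : ℝ) ^ (k + 1)) (G x : ℝ))
    (a₀ : SchwartzMap (HigherNLS.E d) ℂ) (β : SchwartzMap (HigherNLS.E d) ℝ)
    (hβ : HasCompactSupport β) (T : ℝ) (hT : 0 < T) (hβT : tsupport β ⊆ {x | ‖x‖ < T})
    (ξ : HigherNLS.E d) (hξ : ‖ξ‖ = 1) :
    -- existence and uniqueness of the solution for small `ε`, and the error bound
    (∃ ε₀ : ℝ, 0 < ε₀ ∧ ∃ u : ℝ → ℝ → HigherNLS.E d → ℂ,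
      (∀ ε ∈ Ioo 0 ε₀,
        HigherNLS.IsSolution n G β T (HigherNLS.wavePacket n p G a₀ β T ξ ε (-T)) (u ε) ∧
        ∀ w : ℝ → HigherNLS.E d → ℂ,
          HigherNLS.IsSolution n G β T (HigherNLS.wavePacket n p G a₀ β T ξ ε (-T)) w →
          ∀ t ∈ Icc (-T) T, w t = u ε t) ∧
      ∀ σ : ℝ, 0 < σ → ∃ C : ℝ, 0 < C ∧ ∀ ε ∈ Ioo 0 ε₀,
        HigherNLS.normLinftyFL1 T
            (fun t x => u ε t x - HigherNLS.wavePacket n p G a₀ β T ξ ε t x) ≤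
          ENNReal.ofReal (C * max (ε ^ (p + 2)) (ε ^ (3 * p - 2 * n - σ)))) ∧
    -- the final phase of the wave packet carries the X-ray transform of `β` in direction `ξ`
    (∀ ε : ℝ, 0 < ε → ∀ y : HigherNLS.E d, inner ℝ y ξ = 0 →
      HigherNLS.wavePacket n p G a₀ β T ξ ε T (y - T • ξ) =
        ((ε ^ p : ℝ) : ℂ) * a₀ (ε • (y + (2 * T) • ξ)) *
          Complex.exp (-Complex.I *
            (((G (Real.toNNReal (ε ^ (2 * p) * ‖a₀ (ε • (y + (2 * T) • ξ))‖ ^ 2)) : ℝ) *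
              HigherNLS.xray β y ξ : ℝ) : ℂ)) *
          Complex.exp (Complex.I * ((-T + T / (2 * n) : ℝ) : ℂ))) := by

  refine ⟨?_, fun ε hε y hy => ?_⟩
  swap
  · have h1 : y - T • ξ + (T + 2 * T) • ξ = y + (2 * T) • ξ := by module
    have h2 : inner ℝ (y - T • ξ) ξ = -T := by
      rw [inner_sub_left, hy, real_inner_smul_left, real_inner_self_eq_norm_sq, hξ]
      ring
    rw [HigherNLS.wavePacket_eq _ _ _ _ _ _ _ hε, h1, h2, HigherNLS.integral_eq_xray hβT hξ hy]
    ring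
  have hp1 : 1 ≤ p := by
    have : (1 : ℝ) ≤ n := by exact_mod_cast hn
    linarith
  -- the Fourier transform of `β`
  have hβc₁ : HasCompactSupport (Complex.ofRealCLM ∘ β) := hβ.comp_left rfl
  have hβc₂ : ContDiff ℝ (⊤ : ℕ∞) (Complex.ofRealCLM ∘ β) :=
    Complex.ofRealCLM.contDiff.comp (β.smooth ⊤)
  set βc : SchwartzMap (HigherNLS.E d) ℂ := hβc₁.toSchwartzMap hβc₂ with hβc
  set g : HigherNLS.L1 d := (HigherNLS.integrable_schwartzHat βc).toL1 _ with hgdef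
  have hg : ∀ x, (β x : ℂ) = HigherNLS.evalCLM x g := fun x => by
    rw [hgdef, HigherNLS.evalCLM_toL1, HigherNLS.invFourier_schwartzHat]
    rfl
  -- the power series of `G`
  set ρ : ℝ := R / 2 with hρdef
  have hρ : 0 < ρ := by positivity
  set b : ℕ → ℝ := fun k => c (k + 1) / ((k + 1).factorial : ℝ) with hbdef
  have hG' : ∀ x : ℝ≥0, (x : ℝ) < 2 * ρ →
      HasSum (fun k => b k * (x : ℝ) ^ (k + 1)) (G x : ℝ) := fun x hx =>
    hG x (by linarith)
  -- Convergence at the interior point `ρ = R / 2` is absolute, since summability in `ℝ` is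
  -- unconditional.
  have hb : Summable fun k => ‖(b k : ℂ)‖ * ρ ^ k := by
    have h1 := (hG' (NNReal.mk ρ hρ.le) (by rw [NNReal.coe_mk]; linarith)).summable.norm
    refine (h1.mul_left ρ⁻¹).congr fun k => ?_
    rw [NNReal.coe_mk, norm_mul, norm_pow, Real.norm_of_nonneg hρ.le, Complex.norm_real, pow_succ]
    field_simp
  set K := ∑' k, ‖(b k : ℂ)‖ * ρ ^ k with hK
  have hK0 : 0 ≤ K := tsum_nonneg fun k => by positivity
  set m := ∫ z, ‖HigherNLS.schwartzHat a₀ z‖ with hm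
  have hm0 : 0 ≤ m := integral_nonneg fun z => norm_nonneg _
  set J := ∫ z, (1 + ‖z‖) ^ (2 * n + 4) * ‖HigherNLS.schwartzHat a₀ z‖ with hJ
  have hJ0 : 0 ≤ J := integral_nonneg fun z => by positivity
  -- the admissible radius
  set D := 6 * T * ‖g‖ * K with hD
  have hD0 : 0 ≤ D := by positivity
  -- The first entry keeps `|w|²` where the operator series is controlled; the second gives the
  -- smallness condition `D r² ≤ 1/4`, with `D + 1` guarding against `D = 0`.
  set r₀ := Real.sqrt (min (ρ / 2) (1 / (4 * (D + 1)))) with hr₀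
  have hr₀pos : 0 < r₀ := Real.sqrt_pos.2 (lt_min (by positivity) (by positivity))
  have hr₀sq : r₀ ^ 2 = min (ρ / 2) (1 / (4 * (D + 1))) :=
    Real.sq_sqrt (le_min (by positivity) (by positivity))
  have hεr : ∀ ε ∈ Ioo (0 : ℝ) (min 1 (r₀ / (2 * (m + 1)))), 2 * (m + 1) * ε ^ p ≤ r₀ := by
    intro ε hε
    have h1 : ε ≤ 1 := hε.2.le.trans (min_le_left _ _)
    have h2 : ε ≤ r₀ / (2 * (m + 1)) := hε.2.le.trans (min_le_right _ _)
    have h3 : ε ^ p ≤ ε := by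
      simpa using Real.rpow_le_rpow_of_exponent_ge hε.1 h1 hp1
    rw [le_div_iff₀ (by positivity)] at h2
    nlinarith
  have key : ∀ ε ∈ Ioo (0 : ℝ) (min 1 (r₀ / (2 * (m + 1)))), ∃ u : ℝ → HigherNLS.E d → ℂ,
      HigherNLS.IsSolution n G β T (HigherNLS.wavePacket n p G a₀ β T ξ ε (-T)) u ∧
      (∀ w, HigherNLS.IsSolution n G β T (HigherNLS.wavePacket n p G a₀ β T ξ ε (-T)) w →
        ∀ t ∈ Icc (-T) T, w t = u t) ∧
      HigherNLS.normLinftyFL1 T (fun t x => u t x - HigherNLS.wavePacket n p G a₀ β T ξ ε t x) ≤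
        ENNReal.ofReal (2 * T * (2 * n + 1) * J * ε ^ (p + 2) +
          12 * T * ‖g‖ * K * (2 * (m + 1) * ε ^ p) ^ 3) := by
    intro ε hε
    have hε0 : 0 < ε := hε.1
    have hrr : (2 * (m + 1) * ε ^ p) ^ 2 ≤ r₀ ^ 2 :=
      pow_le_pow_left₀ (by positivity) (hεr ε hε) 2
    -- The radius is `2(m + 1)ε^p` rather than the fixed `r₀`, so that the cubic error is
    -- `O(ε^{3p})`; `m + 1` keeps it positive when `a₀ = 0`.
    refine HigherNLS.exists_solution_near_wavePacket hn hξ hT hε0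
      (hε.2.le.trans (min_le_left _ _)) hg hρ hG' hb (by positivity)
      (hrr.trans (hr₀sq.le.trans (min_le_left _ _))) ?_ ?_
    · rw [← hm]
      have : 0 < ε ^ p := by positivity
      nlinarith
    · have h1 : (2 * (m + 1) * ε ^ p) ^ 2 ≤ 1 / (4 * (D + 1)) :=
        hrr.trans (hr₀sq.le.trans (min_le_right _ _))
      calc _ = D * (2 * (m + 1) * ε ^ p) ^ 2 := by rw [hD]; ring
        _ ≤ D * (1 / (4 * (D + 1))) := mul_le_mul_of_nonneg_left h1 hD0
        _ ≤ 1 / 4 := by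
          rw [mul_one_div, div_le_div_iff₀ (by positivity) (by positivity)]
          linarith
  choose! u hu using key
  refine ⟨min 1 (r₀ / (2 * (m + 1))), lt_min one_pos (by positivity), u,
    fun ε hε => ⟨(hu ε hε).1, (hu ε hε).2.1⟩, fun σ hσ => ?_⟩
  have hA0 : 0 ≤ 2 * T * (2 * n + 1) * J := mul_nonneg (by positivity) hJ0
  have hB0 : 0 ≤ 12 * T * ‖g‖ * K := mul_nonneg (by positivity) hK0
  refine ⟨2 * T * (2 * n + 1) * J + 12 * T * ‖g‖ * K * (2 * (m + 1)) ^ 3 + 1,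
    add_pos_of_nonneg_of_pos (add_nonneg hA0 (mul_nonneg hB0 (by positivity))) one_pos,
    fun ε hε => (hu ε hε).2.2.trans (ENNReal.ofReal_le_ofReal ?_)⟩
  exact HigherNLS.error_le_max hA0 hB0 (by positivity) hε.1 (hε.2.le.trans (min_le_left _ _)) hσ.le
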